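/- **Theorem 3.1.** Let $k$ be a field of characteristic zero; all algebras are unital and associative. *Bialgebroids.* Let $(H,R,\alpha,\beta,\Delta,\epsilon)$ be a bialgebroid over $k$, that is: $H$ and $R$ are $k$-algebras; $\alpha:R\to H$ is an algebra map and $\beta:R\to H$ an antialgebra map, with $\alpha(a)\beta(b)=\beta(b)\alpha(a)$ for all $a,b\in R$; $H$ is regarded as an $(R,R)$-bimodule by $axb=\alpha(a)\beta(b)x$; $\Delta:H\to H\otimes_RH$ is a coassociative $(R,R)$-bimodule map with $\Delta(1)=1\otimes_R1$, $\Delta(h)\cdot(\beta(r)\otimes1-1\otimes\alpha(r))=0$ and $\Delta(ab)=\Delta(a)\Delta(b)$, where $H\otimes_kH$ acts on $H\otimes_RH$ by right multiplication; and $\epsilon:H\to R$ is an $(R,R)$-bimodule map with $\epsilon(1)=1$ and $(\epsilon\otimes_R\mathrm{id})\Delta=\mathrm{id}=(\mathrm{id}\otimes_R\epsilon)\Delta$. Write $\Delta(h)=h^{(1)}\otimes_Rh^{(2)}$. Let $T:H\to H$ be a $k$-linear antialgebra map with $$T\beta=\alpha,\qquad m(T\otimes\mathrm{id})\Delta=\beta\,\epsilon\,T,$$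 where $m$ is the multiplication of $H$ (the map $x\otimes_R y\mapsto T(x)y$ is well defined because $T\beta=\alpha$). $(H,R,T)$ is called a *para-Hopf algebroid* if in addition $$T^2=\mathrm{id}_H,\qquad T(h^{(1)})^{(1)}h^{(2)}\otimes_RT(h^{(1)})^{(2)}=1\otimes_RT(h)\quad\text{for all }h\in H.\tag{$*$}$$ *The module $H_\natural$.* Put $H_\natural^0=R$ and $H_\natural^n=H\otimes_R\cdots\otimes_RH$ ($n$ factors) for $n\ge1$. The cofaces $\delta_i:H_\natural^n\to H_\natural^{n+1}$, $0\le i\le n+1$, are $\delta_0(a)=\beta(a)$, $\delta_1(a)=\alpha(a)$ for $n=0$, $a\in R$, and for $n\ge1$ $$\delta_0(h_1\otimes\cdots\otimes h_n)=1\otimes h_1\otimes\cdots\otimes h_n,\qquad \delta_{n+1}(h_1\otimes\cdots\otimes h_n)=h_1\otimes\cdots\otimes h_n\otimes1,$$ $$\delta_i(h_1\otimes\cdots\otimes h_n)=h_1\otimes\cdots\otimes\Delta(h_i)\otimes\cdots\otimes h_n\qquad(1\le i\le n).$$ The codegeneracies $\sigma_i:H_\natural^{n+1}\to H_\natural^{n}$,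 $0\le i\le n$, are $$\sigma_i(h_1\otimes\cdots\otimes h_{n+1})=h_1\otimes\cdots\otimes\epsilon(h_{i+1})\otimes\cdots\otimes h_{n+1}$$ (with $\epsilon(h_{i+1})\in R$ absorbed into a neighbouring factor; $\sigma_0=\epsilon$ for $n=0$). The cyclic operators $\tau_n:H_\natural^n\to H_\natural^n$ are $\tau_0=\mathrm{id}_R$ and, for $n\ge1$, $$\tau_n(h_1\otimes\cdots\otimes h_n)=\Delta^{n-1}(T(h_1))\cdot(h_2\otimes\cdots\otimes h_n\otimes1),$$ where $\Delta^{n-1}:H\to H^{\otimes_Rn}$ is the iterated coproduct and $H^{\otimes_k n}$ acts on $H^{\otimes_Rn}$ by right multiplication. All these maps are well defined. *Statement.* The following are equivalent: 1. $H_\natural$ with $\delta_i,\sigma_i,\tau_n$ is a cocyclic module, i.e. the cosimplicial identities hold, and for all $n\ge0$: $\tau_{n+1}\delta_i=\delta_{i-1}\tau_n$ for $1\le i\le n+1$, $\tau_{n+1}\delta_0=\delta_{n+1}$, $\tau_n\sigma_i=\sigma_{i-1}\tau_{n+1}$ for $1\le i\le n$, $\tau_n\sigma_0=\sigma_n\tau_{n+1}^2$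 (for $\delta_i:H_\natural^n\to H_\natural^{n+1}$, $\sigma_i:H_\natural^{n+1}\to H_\natural^n$), and $\tau_n^{n+1}=\mathrm{id}$; 2. the two conditions in $(*)$ hold; 3. $(H,R,T)$ is a para-Hopf algebroid. -/

import Mathlib

open scoped TensorProduct
open MulOpposite

universe u v

namespace ParaHopf

/-! ### Bimodules over a possibly noncommutative `k`-algebra and their tensor product -/

/-- An `(R, R)`-bimodule over the `k`-algebra `R`: a `k`-module with commuting `k`-linear left and
right actions of `R`. The element `a x b` is `left a (right (op b) x)`. -/
structure RBimodule (k : Type v) (R : Type u) [CommRing k] [Ring R] [Algebra k R] where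
  carrier : Type u
  [addCommGroup : AddCommGroup carrier]
  [module : Module k carrier]
  left : R →ₐ[k] Module.End k carrier
  right : Rᵐᵒᵖ →ₐ[k] Module.End k carrier
  comm : ∀ a b x, left a (right b x) = right b (left a x)

attribute [instance] RBimodule.addCommGroup RBimodule.module

namespace RBimodule

variable {k : Type v} {R : Type u} [CommRing k] [Ring R] [Algebra k R]

instance : CoeSort (RBimodule k R) (Type u) := ⟨RBimodule.carrier⟩

/-- The regular bimodule `R`. -/
abbrev regular (k : Type v) (R : Type u) [CommRing k] [Ring R] [Algebra k R] : RBimodule k R where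
  carrier := R
  left := Algebra.lmul k R
  right := AlgHom.ofLinearMap
    ((LinearMap.mul k R).flip.comp (opLinearEquiv k).symm.toLinearMap)
    (by ext x; simp) (by intro x y; ext z; simp [mul_assoc])
  comm := by intro a b x; simp [mul_assoc]

/-- Left `R`-linearity of a `k`-linear map between bimodules. -/
def IsLeftLinear {M N : RBimodule k R} (f : M →ₗ[k] N) : Prop :=
  ∀ a x, f (M.left a x) = N.left a (f x)

/-- Right `R`-linearity of a `k`-linear map between bimodules. -/
def IsRightLinear {M N : RBimodule k R} (f : M →ₗ[k] N) : Prop :=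
  ∀ b x, f (M.right b x) = N.right b (f x)

/-- The relations `x r ⊗ y = x ⊗ r y`. -/
def balancing (M N : RBimodule k R) : Submodule k (M ⊗[k] N) :=
  Submodule.span k {z | ∃ (r : R) (x : M) (y : N),
    z = M.right (op r) x ⊗ₜ[k] y - x ⊗ₜ[k] N.left r y}

/-- The underlying `k`-module of `M ⊗_R N`. -/
abbrev TensorCarrier (M N : RBimodule k R) : Type u := (M ⊗[k] N) ⧸ balancing M N

/-- The action `f ⊗ g` on `M ⊗_R N`, for `f` right linear and `g` left linear. -/
def mapCarrier {M N : RBimodule k R} (f : M →ₗ[k] M) (g : N →ₗ[k] N) (hf : IsRightLinear f)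
    (hg : IsLeftLinear g) : TensorCarrier M N →ₗ[k] TensorCarrier M N :=
  (balancing M N).mapQ (balancing M N) (TensorProduct.map f g) (by
    refine Submodule.span_le.2 ?_
    rintro z ⟨r, x, y, rfl⟩
    exact Submodule.subset_span ⟨r, f x, g y, by simp [hf _ _, hg _ _]⟩)

theorem carrier_ext {M N : RBimodule k R} {Q : Type*} [AddCommGroup Q] [Module k Q]
    {f g : TensorCarrier M N →ₗ[k] Q}
    (h : ∀ x y, f ((balancing M N).mkQ (x ⊗ₜ y)) = g ((balancing M N).mkQ (x ⊗ₜ y))) :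
    f = g := by
  ext x y
  exact h x y

theorem mapCarrier_mk {M N : RBimodule k R} (f : M →ₗ[k] M) (g : N →ₗ[k] N)
    (hf : IsRightLinear f) (hg : IsLeftLinear g) (x : M) (y : N) :
    mapCarrier f g hf hg ((balancing M N).mkQ (x ⊗ₜ y)) = (balancing M N).mkQ (f x ⊗ₜ g y) :=
  rfl

theorem IsLeftLinear.id (M : RBimodule k R) :
    IsLeftLinear (M := M) (N := M) LinearMap.id := fun _ _ => rfl

theorem IsRightLinear.id (M : RBimodule k R) :
    IsRightLinear (M := M) (N := M) LinearMap.id := fun _ _ => rfl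

/-- The bimodule tensor product `M ⊗_R N`, with `a (x ⊗ y) b = (a x) ⊗ (y b)`. -/
def tensor (M N : RBimodule k R) : RBimodule k R where
  carrier := TensorCarrier M N
  left := AlgHom.ofLinearMap
    { toFun := fun a => mapCarrier (M.left a) LinearMap.id
        (fun b x => M.comm a b x) (IsLeftLinear.id N)
      map_add' := fun a b => carrier_ext fun x y => by
        change (balancing M N).mkQ (M.left (a + b) x ⊗ₜ y) =
          (balancing M N).mkQ (M.left a x ⊗ₜ y) + (balancing M N).mkQ (M.left b x ⊗ₜ y)
        rw [map_add, LinearMap.add_apply, TensorProduct.add_tmul, map_add]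
      map_smul' := fun c a => carrier_ext fun x y => by
        change (balancing M N).mkQ (M.left (c • a) x ⊗ₜ y) =
          c • (balancing M N).mkQ (M.left a x ⊗ₜ y)
        rw [map_smul, LinearMap.smul_apply, ← TensorProduct.smul_tmul', map_smul] }
    (carrier_ext fun x y => by
      change (balancing M N).mkQ (M.left 1 x ⊗ₜ y) = (balancing M N).mkQ (x ⊗ₜ y)
      rw [map_one, Module.End.one_apply])
    (fun a b => carrier_ext fun x y => by
      change (balancing M N).mkQ (M.left (a * b) x ⊗ₜ y) =
        (balancing M N).mkQ (M.left a (M.left b x) ⊗ₜ y)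
      rw [map_mul, Module.End.mul_apply])
  right := AlgHom.ofLinearMap
    { toFun := fun b => mapCarrier LinearMap.id (N.right b)
        (IsRightLinear.id M) (fun a x => (N.comm a b x).symm)
      map_add' := fun a b => carrier_ext fun x y => by
        change (balancing M N).mkQ (x ⊗ₜ N.right (a + b) y) =
          (balancing M N).mkQ (x ⊗ₜ N.right a y) + (balancing M N).mkQ (x ⊗ₜ N.right b y)
        rw [map_add, LinearMap.add_apply, TensorProduct.tmul_add, map_add]
      map_smul' := fun c a => carrier_ext fun x y => by
        change (balancing M N).mkQ (x ⊗ₜ N.right (c • a) y) =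
          c • (balancing M N).mkQ (x ⊗ₜ N.right a y)
        rw [map_smul, LinearMap.smul_apply, TensorProduct.tmul_smul, map_smul] }
    (carrier_ext fun x y => by
      change (balancing M N).mkQ (x ⊗ₜ N.right 1 y) = (balancing M N).mkQ (x ⊗ₜ y)
      rw [map_one, Module.End.one_apply])
    (fun a b => carrier_ext fun x y => by
      change (balancing M N).mkQ (x ⊗ₜ N.right (a * b) y) =
        (balancing M N).mkQ (x ⊗ₜ N.right a (N.right b y))
      rw [map_mul, Module.End.mul_apply])
  comm := fun a b => LinearMap.congr_fun
    (f := mapCarrier (M.left a) LinearMap.id (fun b x => M.comm a b x) (IsLeftLinear.id N) ∘ₗ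
      mapCarrier LinearMap.id (N.right b) (IsRightLinear.id M) (fun a x => (N.comm a b x).symm))
    (g := mapCarrier LinearMap.id (N.right b) (IsRightLinear.id M)
        (fun a x => (N.comm a b x).symm) ∘ₗ
      mapCarrier (M.left a) LinearMap.id (fun b x => M.comm a b x) (IsLeftLinear.id N))
    (carrier_ext fun _ _ => rfl)

section maps
variable {M N P M' N' : RBimodule k R}

/-- The canonical projection `M ⊗_k N → M ⊗_R N`. -/
def proj (M N : RBimodule k R) : M ⊗[k] N →ₗ[k] tensor M N := (balancing M N).mkQ

theorem proj_surjective : Function.Surjective (proj M N) := (balancing M N).mkQ_surjective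

/-- The pure tensor `x ⊗_R y`, as a bilinear map. -/
def tmul (M N : RBimodule k R) : M →ₗ[k] N →ₗ[k] tensor M N :=
  (TensorProduct.mk k M N).compr₂ (proj M N)

@[simp] theorem proj_tmul (x : M) (y : N) : proj M N (x ⊗ₜ y) = tmul M N x y := rfl

theorem balanced (r : R) (x : M) (y : N) :
    tmul M N (M.right (op r) x) y = tmul M N x (N.left r y) := by
  have h : M.right (op r) x ⊗ₜ[k] y - x ⊗ₜ[k] N.left r y ∈ balancing M N :=
    Submodule.subset_span ⟨r, x, y, rfl⟩
  exact (Submodule.Quotient.eq _).2 h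

/-- The map on `M ⊗_R N` induced by an `R`-balanced `k`-bilinear map. -/
def tensorLift {Q : Type*} [AddCommGroup Q] [Module k Q] (f : M →ₗ[k] N →ₗ[k] Q)
    (hf : ∀ r x y, f (M.right (op r) x) y = f x (N.left r y)) : tensor M N →ₗ[k] Q :=
  (balancing M N).liftQ (TensorProduct.lift f) (by
    refine Submodule.span_le.2 ?_
    rintro z ⟨r, x, y, rfl⟩
    simp [hf])

@[simp] theorem tensorLift_tmul {Q : Type*} [AddCommGroup Q] [Module k Q] (f : M →ₗ[k] N →ₗ[k] Q)
    (hf : ∀ r x y, f (M.right (op r) x) y = f x (N.left r y)) (x : M) (y : N) :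
    tensorLift f hf (tmul M N x y) = f x y :=
  TensorProduct.lift.tmul x y

theorem tensorInduction {p : tensor M N → Prop} (z : tensor M N)
    (tm : ∀ x y, p (tmul M N x y)) (ad : ∀ a b, p a → p b → p (a + b)) : p z := by
  obtain ⟨w, rfl⟩ := proj_surjective z
  induction w with
  | zero => simpa using tm 0 0
  | tmul x y => exact tm x y
  | add a b ha hb => rw [map_add]; exact ad _ _ ha hb

theorem tensor_hom_ext {Q : Type*} [AddCommGroup Q] [Module k Q] {f g : tensor M N →ₗ[k] Q}
    (h : ∀ x y, f (tmul M N x y) = g (tmul M N x y)) : f = g := by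
  ext z
  induction z using tensorInduction with
  | tm x y => exact h x y
  | ad x y hx hy => simp only [map_add, hx, hy]

@[simp] theorem tensor_left_tmul (a : R) (x : M) (y : N) :
    (tensor M N).left a (tmul M N x y) = tmul M N (M.left a x) y := rfl

@[simp] theorem tensor_right_tmul (b : Rᵐᵒᵖ) (x : M) (y : N) :
    (tensor M N).right b (tmul M N x y) = tmul M N x (N.right b y) := rfl

/-- `f ⊗_R g`, for `f` right linear and `g` left linear. -/
def tensorMap (f : M →ₗ[k] M') (g : N →ₗ[k] N') (hf : IsRightLinear f) (hg : IsLeftLinear g) :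
    tensor M N →ₗ[k] tensor M' N' :=
  tensorLift ((tmul M' N').compl₁₂ f g) (by
    intro r x y
    simp only [LinearMap.compl₁₂_apply, hf _ _, hg _ _, balanced])

@[simp] theorem tensorMap_tmul (f : M →ₗ[k] M') (g : N →ₗ[k] N') (hf : IsRightLinear f)
    (hg : IsLeftLinear g) (x : M) (y : N) :
    tensorMap f g hf hg (tmul M N x y) = tmul M' N' (f x) (g y) := tensorLift_tmul _ _ x y

/-- The canonical map `(M ⊗_R N) ⊗_R P → M ⊗_R (N ⊗_R P)`,
`(x ⊗ y) ⊗ z ↦ x ⊗ (y ⊗ z)`. -/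
def assoc (M N P : RBimodule k R) : tensor (tensor M N) P →ₗ[k] tensor M (tensor N P) :=
  tensorLift
    (tensorLift
      { toFun := fun x => (tmul N P).compr₂ (tmul M (tensor N P) x)
        map_add' := fun x x' => by ext; simp
        map_smul' := fun c x => by ext; simp }
      (by
        intro r x y
        ext z
        simp only [LinearMap.coe_mk, AddHom.coe_mk, LinearMap.compr₂_apply, balanced,
          tensor_left_tmul]))
    (by
      intro r w z
      induction w using tensorInduction with
      | tm x y =>
        simp only [tensor_right_tmul, tensorLift_tmul, LinearMap.coe_mk, AddHom.coe_mk,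
          LinearMap.compr₂_apply, balanced]
      | ad a b ha hb => simp only [map_add, LinearMap.add_apply, ha, hb])

@[simp] theorem assoc_tmul (x : M) (y : N) (z : P) :
    assoc M N P (tmul (tensor M N) P (tmul M N x y) z)
      = tmul M (tensor N P) x (tmul N P y z) := by
  simp [assoc]

/-- The canonical map `R ⊗_R M → M`, `r ⊗ x ↦ r x`. -/
def leftUnit (M : RBimodule k R) : tensor (regular k R) M →ₗ[k] M :=
  tensorLift (M := regular k R) M.left.toLinearMap (by intro r x y; simp)

@[simp] theorem leftUnit_tmul (r : R) (x : M) :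
    leftUnit M (tmul (regular k R) M r x) = M.left r x :=
  tensorLift_tmul (M := regular k R) _ _ r x

/-- The canonical map `M ⊗_R R → M`, `x ⊗ r ↦ x r`. -/
def rightUnit (M : RBimodule k R) : tensor M (regular k R) →ₗ[k] M :=
  tensorLift (N := regular k R)
    (M.right.toLinearMap.comp (opLinearEquiv k).toLinearMap).flip (by intro r x y; simp)

@[simp] theorem rightUnit_tmul (x : M) (r : R) :
    rightUnit M (tmul M (regular k R) x r) = M.right (op r) x :=
  tensorLift_tmul (N := regular k R) _ _ x r

theorem IsLeftLinear.comp {f : N →ₗ[k] P} {g : M →ₗ[k] N} (hf : IsLeftLinear f)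
    (hg : IsLeftLinear g) : IsLeftLinear (f ∘ₗ g) := fun a x => by
  simp only [LinearMap.comp_apply, hg a x, hf a (g x)]

theorem isLeftLinear_tensorMap {f : M →ₗ[k] M'} {g : N →ₗ[k] N'} (hf : IsRightLinear f)
    (hg : IsLeftLinear g) (hf' : IsLeftLinear f) : IsLeftLinear (tensorMap f g hf hg) := by
  intro a z
  induction z using tensorInduction with
  | tm x y => rw [tensor_left_tmul, tensorMap_tmul, tensorMap_tmul, tensor_left_tmul, hf']
  | ad x y hx hy => simp only [map_add, hx, hy]

theorem isLeftLinear_assoc : IsLeftLinear (assoc M N P) := by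
  intro a z
  induction z using tensorInduction with
  | tm w z =>
    induction w using tensorInduction with
    | tm x y => simp
    | ad x y hx hy => simp only [map_add, LinearMap.add_apply, tensor_left_tmul] at *; rw [hx, hy]
  | ad x y hx hy => simp only [map_add, hx, hy]

theorem isLeftLinear_leftUnit : IsLeftLinear (leftUnit M) := by
  intro a z
  induction z using tensorInduction with
  | tm x y => rw [tensor_left_tmul, leftUnit_tmul, leftUnit_tmul]; simp
  | ad x y hx hy => simp only [map_add, hx, hy]

theorem isLeftLinear_rightUnit : IsLeftLinear (rightUnit M) := by
  intro a z
  induction z using tensorInduction with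
  | tm x y => rw [tensor_left_tmul, rightUnit_tmul, rightUnit_tmul, M.comm]
  | ad x y hx hy => simp only [map_add, hx, hy]

end maps

end RBimodule

open RBimodule

/-! ### Bialgebroids -/

/-- Source and target maps: an algebra homomorphism `α : R → H` and an anti-homomorphism
`β : R → H` (a homomorphism on `Rᵐᵒᵖ`) whose images commute. -/
structure SourceTarget (k : Type v) (R H : Type u) [CommRing k] [Ring R] [Algebra k R]
    [Ring H] [Algebra k H] where
  α : R →ₐ[k] H
  β : Rᵐᵒᵖ →ₐ[k] H
  comm : ∀ a b, α a * β b = β b * α a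

variable {k : Type v} {R H : Type u} [CommRing k] [Ring R] [Algebra k R] [Ring H] [Algebra k H]

namespace SourceTarget

/-- `H` as an `(R, R)`-bimodule, `a x b = α(a) β(b) x`. -/
abbrev bim (S : SourceTarget k R H) : RBimodule k R where
  carrier := H
  left := (Algebra.lmul k H).comp S.α
  right := (Algebra.lmul k H).comp S.β
  comm := by
    intro a b x
    simp [← mul_assoc, S.comm]

/-- For a bimodule `N` and a multiplication `ρ : H → End_k(N)` extending the left action of `R`, the
map `u ↦ (w ↦ u · w)`, `H ⊗_R H → Hom_k(H ⊗_k N, H ⊗_R N)`,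
`(a ⊗_R b) · (x ⊗ y) = a x ⊗_R ρ(b) y`. -/
def act (S : SourceTarget k R H) (N : RBimodule k R) (ρ : H →ₐ[k] Module.End k N)
    (hρ : ∀ r, ρ (S.α r) = N.left r) :
    tensor S.bim S.bim →ₗ[k] (H ⊗[k] N →ₗ[k] tensor S.bim N) :=
  tensorLift (M := S.bim) (N := S.bim)
    (LinearMap.mk₂ k
      (fun a b => TensorProduct.lift
        ((tmul S.bim N).compl₁₂ (LinearMap.mulLeft k a) (ρ b)))
      (by intro a a' b; ext x y; simp [add_mul])
      (by intro c a b; ext x y; simp)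
      (by intro a b b'; ext x y; simp)
      (by intro c a b; ext x y; simp))
    (by
      intro r a b
      ext x y
      have := balanced (M := S.bim) (N := N) r (a * x) (ρ b y)
      simpa [hρ, mul_assoc] using this)

@[simp] theorem act_tmul (S : SourceTarget k R H) (N : RBimodule k R)
    (ρ : H →ₐ[k] Module.End k N) (hρ : ∀ r, ρ (S.α r) = N.left r) (a b x : H) (y : N) :
    S.act N ρ hρ (tmul S.bim S.bim a b) (x ⊗ₜ y) = tmul S.bim N (a * x) (ρ b y) := by
  rw [act]
  erw [tensorLift_tmul]
  rfl

theorem lmul_source (S : SourceTarget k R H) (r : R) :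
    Algebra.lmul k H (S.α r) = S.bim.left r := rfl

/-- The right action of `H ⊗_k H` on `H ⊗_R H`, `(a ⊗_R b) · (x ⊗ y) = a x ⊗_R b y`. -/
def rightAct (S : SourceTarget k R H) :
    tensor S.bim S.bim →ₗ[k] (H ⊗[k] H →ₗ[k] tensor S.bim S.bim) :=
  S.act S.bim (Algebra.lmul k H) S.lmul_source

@[simp] theorem rightAct_tmul (S : SourceTarget k R H) (a b x y : H) :
    S.rightAct (tmul S.bim S.bim a b) (x ⊗ₜ y) = tmul S.bim S.bim (a * x) (b * y) :=
  S.act_tmul S.bim (Algebra.lmul k H) S.lmul_source a b x y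

end SourceTarget

/-- A bialgebroid `(H, R, α, β, Δ, ε)` over `k`. -/
structure Bialgebroid (k : Type v) (R H : Type u) [CommRing k] [Ring R] [Algebra k R]
    [Ring H] [Algebra k H] extends SourceTarget k R H where
  Δ : toSourceTarget.bim →ₗ[k] tensor toSourceTarget.bim toSourceTarget.bim
  Δ_left : IsLeftLinear Δ
  Δ_right : IsRightLinear Δ
  Δ_one : Δ (1 : H) = tmul toSourceTarget.bim toSourceTarget.bim (1 : H) (1 : H)
  coassoc : ∀ h, assoc _ _ _ (tensorMap Δ LinearMap.id Δ_right (IsLeftLinear.id _) (Δ h)) =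
    tensorMap LinearMap.id Δ (IsRightLinear.id _) Δ_left (Δ h)
  Δ_target_source : ∀ (h : H) (r : R),
    toSourceTarget.rightAct (Δ h) (β (op r) ⊗ₜ 1 - 1 ⊗ₜ α r) = 0
  /-- `Δ(a b) = Δ(a) Δ(b)`, where `Δ(b)` is represented by any element `w` of `H ⊗_k H`. -/
  Δ_mul : ∀ (a b : H) (w : H ⊗[k] H), proj toSourceTarget.bim toSourceTarget.bim w = Δ b →
    Δ (a * b) = toSourceTarget.rightAct (Δ a) w
  ε : toSourceTarget.bim →ₗ[k] regular k R
  ε_left : IsLeftLinear ε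
  ε_right : IsRightLinear ε
  ε_one : ε (1 : H) = (1 : R)
  counit_left : ∀ h, leftUnit _ (tensorMap ε LinearMap.id ε_right (IsLeftLinear.id _) (Δ h)) = h
  counit_right : ∀ h, rightUnit _ (tensorMap LinearMap.id ε (IsRightLinear.id _) ε_left (Δ h)) = h

namespace Bialgebroid

variable (B : Bialgebroid k R H)

/-! ### The diagonal action -/

section diagonal

variable (N : RBimodule k R) (ρ : H →ₐ[k] Module.End k N)
  (hρ : ∀ r, ρ (B.α r) = N.left r)

theorem Δ_source (r : R) : B.Δ (B.α r) = tmul B.bim B.bim (B.α r) (1 : H) := by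
  have h := B.Δ_left r (1 : H)
  rw [B.Δ_one, tensor_left_tmul] at h
  simpa using h

theorem act_rightAct (u : tensor B.bim B.bim) (w : H ⊗[k] H) (x : H) (y : N) :
    B.act N ρ hρ (B.rightAct u w) (x ⊗ₜ y) =
      B.act N ρ hρ u (TensorProduct.map (LinearMap.mulRight k x)
        (ρ.toLinearMap.flip y) w) := by
  induction w with
  | zero => simp
  | tmul c d =>
    induction u using tensorInduction with
    | tm a b =>
      rw [SourceTarget.rightAct_tmul, SourceTarget.act_tmul, TensorProduct.map_tmul]
      have h := B.act_tmul N ρ hρ a b (c * x) (ρ d y)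
      rw [← mul_assoc] at h
      simpa using h.symm
    | ad u v hu hv => simp only [map_add, LinearMap.add_apply, hu, hv]
  | add c d hc hd => simp only [map_add, LinearMap.add_apply, hc, hd]

theorem act_balanced (h : H) (r : R) (x : H) (y : N) :
    B.act N ρ hρ (B.Δ h) ((B.β (op r) * x) ⊗ₜ y) =
      B.act N ρ hρ (B.Δ h) (x ⊗ₜ N.left r y) := by
  have e := B.act_rightAct N ρ hρ (B.Δ h) (B.β (op r) ⊗ₜ 1 - 1 ⊗ₜ B.α r) x y
  rw [B.Δ_target_source] at e
  simp only [map_zero, LinearMap.zero_apply, map_sub, TensorProduct.map_tmul,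
    LinearMap.mulRight_apply, LinearMap.flip_apply, AlgHom.toLinearMap_apply, map_one,
    Module.End.one_apply, one_mul, hρ] at e
  exact (sub_eq_zero.1 e.symm)

/-- The operator `x ⊗ y ↦ a⁽¹⁾ x ⊗ ρ(a⁽²⁾) y` on `H ⊗_R N`. -/
def diagFun (a : H) : tensor B.bim N →ₗ[k] tensor B.bim N :=
  tensorLift (M := B.bim) (N := N) (TensorProduct.curry (B.act N ρ hρ (B.Δ a)))
    (fun r x y => B.act_balanced N ρ hρ a r x y)

theorem diagFun_tmul (a x : H) (y : N) :
    B.diagFun N ρ hρ a (tmul B.bim N x y) = B.act N ρ hρ (B.Δ a) (x ⊗ₜ y) :=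
  tensorLift_tmul (M := B.bim) (N := N) _ _ x y

theorem diagFun_mul (a b : H) :
    B.diagFun N ρ hρ (a * b) = B.diagFun N ρ hρ a ∘ₗ B.diagFun N ρ hρ b :=
  tensor_hom_ext fun (x : H) y => by
    obtain ⟨w, hw⟩ := proj_surjective (M := B.bim) (N := B.bim) (B.Δ b)
    rw [LinearMap.comp_apply, diagFun_tmul, diagFun_tmul, B.Δ_mul a b w hw, act_rightAct, ← hw]
    clear hw
    induction w with
    | zero => simp
    | tmul c d =>
      rw [TensorProduct.map_tmul, ← B.diagFun_tmul]
      exact congrArg (B.diagFun N ρ hρ a) (B.act_tmul N ρ hρ c d x y).symm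
    | add c d hc hd => simp only [map_add, LinearMap.add_apply, hc, hd]

/-- The diagonal action of `H` on `H ⊗_R N`, `a ▷ (x ⊗ y) = a⁽¹⁾ x ⊗ ρ(a⁽²⁾) y`, as an algebra
homomorphism. -/
def diagStep : H →ₐ[k] Module.End k (tensor B.bim N) :=
  AlgHom.ofLinearMap
    { toFun := B.diagFun N ρ hρ
      map_add' := fun a b => tensor_hom_ext fun (x : H) y => by
        rw [LinearMap.add_apply, diagFun_tmul, diagFun_tmul, diagFun_tmul]
        erw [map_add, map_add]
        rfl
      map_smul' := fun c a => tensor_hom_ext fun (x : H) y => by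
        rw [LinearMap.smul_apply, diagFun_tmul, diagFun_tmul]
        erw [map_smul, map_smul]
        rfl }
    (tensor_hom_ext fun (x : H) y => by
      change B.diagFun N ρ hρ 1 _ = _
      rw [diagFun_tmul, B.Δ_one, SourceTarget.act_tmul, one_mul, map_one]
      rfl)
    (B.diagFun_mul N ρ hρ)

theorem diagStep_tmul (a x : H) (y : N) :
    B.diagStep N ρ hρ a (tmul B.bim N x y) = B.act N ρ hρ (B.Δ a) (x ⊗ₜ y) :=
  B.diagFun_tmul N ρ hρ a x y

theorem diagStep_source (r : R) : B.diagStep N ρ hρ (B.α r) = (tensor B.bim N).left r :=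
  tensor_hom_ext fun (x : H) y => by
    rw [diagStep_tmul, Δ_source, SourceTarget.act_tmul, map_one, tensor_left_tmul]
    rfl

end diagonal

/-! ### The modules `H_♮^n` -/

/-- `H_♮^0 = R` and `H_♮^n = H ⊗_R ⋯ ⊗_R H` (`n` factors) for `n ≥ 1`. -/
def cn : ℕ → RBimodule k R
  | 0 => regular k R
  | 1 => B.bim
  | n + 2 => tensor B.bim (cn (n + 1))

/-- The diagonal action of `H` on `H^{⊗_R (n+1)}`,
`a ▷ (g₀ ⊗ ⋯ ⊗ gₙ) = a⁽¹⁾ g₀ ⊗ ⋯ ⊗ a⁽ⁿ⁺¹⁾ gₙ`, with its compatibility with the left action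
of `R`. -/
def diagAux : (n : ℕ) →
    {ρ : H →ₐ[k] Module.End k (B.cn (n + 1)) // ∀ r, ρ (B.α r) = (B.cn (n + 1)).left r}
  | 0 => ⟨Algebra.lmul k H, fun _ => rfl⟩
  | n + 1 => ⟨B.diagStep (B.cn (n + 1)) (diagAux n).1 (diagAux n).2,
      B.diagStep_source (B.cn (n + 1)) (diagAux n).1 (diagAux n).2⟩

/-- The diagonal action `a ▷ (g₀ ⊗ ⋯ ⊗ gₙ) = a⁽¹⁾ g₀ ⊗ ⋯ ⊗ a⁽ⁿ⁺¹⁾ gₙ = Δⁿ(a) · (g₀ ⊗ ⋯ ⊗ gₙ)` of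
`H` on `H^{⊗_R (n+1)}`. -/
def diag (n : ℕ) : H →ₐ[k] Module.End k (B.cn (n + 1)) := (B.diagAux n).1

theorem diag_source (n : ℕ) (r : R) : B.diag n (B.α r) = (B.cn (n + 1)).left r :=
  (B.diagAux n).2 r

/-! ### Cofaces and codegeneracies -/

/-- `x ↦ 1 ⊗ x`. -/
def unitTensor (N : RBimodule k R) : N →ₗ[k] tensor B.bim N := tmul B.bim N (1 : H)

/-- `h ↦ h ⊗ 1`. -/
def tensorUnit : B.bim →ₗ[k] tensor B.bim B.bim := (tmul B.bim B.bim).flip (1 : H)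

theorem tensorUnit_left : IsLeftLinear B.tensorUnit := fun _ _ => rfl

theorem source_left : IsLeftLinear (M := regular k R) (N := B.bim) B.α.toLinearMap :=
  fun a x => by simp

/-- The positive cofaces: `cofaceSucc n i` is `δ_{i+1}` on `H_♮^n`, for `0 ≤ i ≤ n`. On `H_♮^0 = R`
it is `r ↦ α(r) = r · 1_H`; for `1 ≤ i + 1 ≤ n` it is
`h₁ ⊗ ⋯ ⊗ hₙ ↦ h₁ ⊗ ⋯ ⊗ Δ(h_{i+1}) ⊗ ⋯ ⊗ hₙ`, and `δ_{n+1}` appends `1_H`.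
(The values for `i > n` are not used.) -/
def cofaceSucc : (n i : ℕ) → {f : B.cn n →ₗ[k] B.cn (n + 1) // IsLeftLinear f}
  | 0, _ => ⟨B.α.toLinearMap, B.source_left⟩
  | 1, 0 => ⟨B.Δ, B.Δ_left⟩
  | 1, _ + 1 => ⟨B.tensorUnit, B.tensorUnit_left⟩
  | n + 2, 0 => ⟨assoc B.bim B.bim (B.cn (n + 1)) ∘ₗ
        tensorMap B.Δ LinearMap.id B.Δ_right (IsLeftLinear.id (B.cn (n + 1))),
      isLeftLinear_assoc.comp (isLeftLinear_tensorMap B.Δ_right (IsLeftLinear.id _) B.Δ_left)⟩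
  | n + 2, i + 1 => ⟨tensorMap (M := B.bim) (M' := B.bim) LinearMap.id (cofaceSucc (n + 1) i).1
        (IsRightLinear.id B.bim) (cofaceSucc (n + 1) i).2,
      isLeftLinear_tensorMap (IsRightLinear.id B.bim) (cofaceSucc (n + 1) i).2
        (IsLeftLinear.id B.bim)⟩

/-- The cofaces `δ_i : H_♮^n → H_♮^{n+1}`, `0 ≤ i ≤ n + 1`. Here `δ_0` is `x ↦ 1_H ⊗ x`, which on
`H_♮^0 = R` is `r ↦ 1_H · r = β(r)`. -/
def coface : (n i : ℕ) → (B.cn n →ₗ[k] B.cn (n + 1))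
  | 0, 0 => B.β.toLinearMap ∘ₗ (opLinearEquiv k).toLinearMap
  | n + 1, 0 => B.unitTensor (B.cn (n + 1))
  | n, i + 1 => (B.cofaceSucc n i).1

/-- The codegeneracies `σ_i : H_♮^{n+1} → H_♮^n`, `0 ≤ i ≤ n`,
`h₁ ⊗ ⋯ ⊗ h_{n+1} ↦ h₁ ⊗ ⋯ ⊗ ε(h_{i+1}) ⊗ ⋯ ⊗ h_{n+1}`, with their left `R`-linearity.
(The values for `i > n` are not used.) -/
def codegAux : (n i : ℕ) → {f : B.cn (n + 1) →ₗ[k] B.cn n // IsLeftLinear f}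
  | 0, _ => ⟨B.ε, B.ε_left⟩
  | n + 1, 0 => ⟨leftUnit (B.cn (n + 1)) ∘ₗ
        tensorMap B.ε LinearMap.id B.ε_right (IsLeftLinear.id (B.cn (n + 1))),
      isLeftLinear_leftUnit.comp
        (isLeftLinear_tensorMap B.ε_right (IsLeftLinear.id _) B.ε_left)⟩
  | 1, _ + 1 => ⟨rightUnit B.bim ∘ₗ
        tensorMap LinearMap.id B.ε (IsRightLinear.id B.bim) B.ε_left,
      isLeftLinear_rightUnit.comp
        (isLeftLinear_tensorMap (IsRightLinear.id B.bim) B.ε_left (IsLeftLinear.id B.bim))⟩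
  | n + 2, i + 1 => ⟨tensorMap (M := B.bim) (M' := B.bim) LinearMap.id (codegAux (n + 1) i).1
        (IsRightLinear.id B.bim) (codegAux (n + 1) i).2,
      isLeftLinear_tensorMap (IsRightLinear.id B.bim) (codegAux (n + 1) i).2
        (IsLeftLinear.id B.bim)⟩

/-- The codegeneracies `σ_i : H_♮^{n+1} → H_♮^n`, `0 ≤ i ≤ n`. -/
def codeg (n i : ℕ) : B.cn (n + 1) →ₗ[k] B.cn n := (B.codegAux n i).1

/-! ### Formulas on pure tensors -/

/-- The pure tensor `g₀ ⊗ ⋯ ⊗ gₙ` in `H^{⊗_R (n+1)}`. -/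
def pure : (n : ℕ) → (Fin (n + 1) → H) → B.cn (n + 1)
  | 0, g => g 0
  | n + 1, g => tmul B.bim (B.cn (n + 1)) (g 0) (pure n (Fin.tail g))

theorem pure_succ (n : ℕ) (g : Fin (n + 2) → H) :
    B.pure (n + 1) g = tmul B.bim (B.cn (n + 1)) (g 0) (B.pure n (Fin.tail g)) := rfl

/-- The right action `(h₀ ⊗ ⋯ ⊗ hₙ) · (g₀ ⊗ ⋯ ⊗ gₙ) = h₀ g₀ ⊗ ⋯ ⊗ hₙ gₙ` on `H^{⊗_R (n+1)}`. -/
def mulPureAux : (n : ℕ) → (Fin (n + 1) → H) →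
    {f : B.cn (n + 1) →ₗ[k] B.cn (n + 1) // IsLeftLinear f}
  | 0, g => ⟨LinearMap.mulRight k (g 0), fun a x => mul_assoc (B.α a) x (g 0)⟩
  | n + 1, g => ⟨tensorMap (M := B.bim) (M' := B.bim) (LinearMap.mulRight k (g 0))
        (mulPureAux n (Fin.tail g)).1 (fun b x => mul_assoc (B.β b) x (g 0))
        (mulPureAux n (Fin.tail g)).2,
      isLeftLinear_tensorMap (M := B.bim) (M' := B.bim) (fun b x => mul_assoc (B.β b) x (g 0))
        (mulPureAux n (Fin.tail g)).2 (fun a x => mul_assoc (B.α a) x (g 0))⟩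

/-- The right action `(h₀ ⊗ ⋯ ⊗ hₙ) · (g₀ ⊗ ⋯ ⊗ gₙ) = h₀ g₀ ⊗ ⋯ ⊗ hₙ gₙ` on `H^{⊗_R (n+1)}`. -/
def mulPure (n : ℕ) (g : Fin (n + 1) → H) : B.cn (n + 1) →ₗ[k] B.cn (n + 1) :=
  (B.mulPureAux n g).1

/-- The iterated coproduct `Δⁿ : H → H^{⊗_R (n+1)}`, `Δ⁰ = id`, `Δⁿ⁺¹ = (id ⊗ Δⁿ)Δ`. -/
def iterΔAux : (n : ℕ) → {f : B.bim →ₗ[k] B.cn (n + 1) // IsLeftLinear f}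
  | 0 => ⟨LinearMap.id, IsLeftLinear.id B.bim⟩
  | n + 1 => ⟨tensorMap LinearMap.id (iterΔAux n).1 (IsRightLinear.id B.bim) (iterΔAux n).2 ∘ₗ B.Δ,
      (isLeftLinear_tensorMap (IsRightLinear.id B.bim) (iterΔAux n).2
        (IsLeftLinear.id B.bim)).comp B.Δ_left⟩

/-- The iterated coproduct `Δⁿ : H → H^{⊗_R (n+1)}`, `Δ⁰ = id`, `Δⁿ⁺¹ = (id ⊗ Δⁿ)Δ`. -/
def iterΔ (n : ℕ) : B.bim →ₗ[k] B.cn (n + 1) := (B.iterΔAux n).1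

/-- `a ▷ (g₀ ⊗ ⋯ ⊗ gₙ) = Δⁿ(a) · (g₀ ⊗ ⋯ ⊗ gₙ)`. -/
theorem diag_pure (n : ℕ) (a : H) (g : Fin (n + 1) → H) :
    B.diag n a (B.pure n g) = B.mulPure n g (B.iterΔ n a) := by
  induction n generalizing a with
  | zero => rfl
  | succ n ih =>
    refine (B.diagStep_tmul (B.cn (n + 1)) _ (B.diagAux n).2 a (g 0)
      (B.pure n (Fin.tail g))).trans ?_
    change _ = (B.mulPureAux (n + 1) g).1 (tensorMap LinearMap.id (B.iterΔAux n).1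
      (IsRightLinear.id B.bim) (B.iterΔAux n).2 (B.Δ a))
    generalize B.Δ a = u
    induction u using tensorInduction with
    | tm p q =>
      refine (B.act_tmul (B.cn (n + 1)) _ (B.diagAux n).2 p q (g 0)
        (B.pure n (Fin.tail g))).trans ?_
      rw [tensorMap_tmul]
      refine Eq.trans ?_ (tensorMap_tmul (M := B.bim) (M' := B.bim)
        (LinearMap.mulRight k (g 0)) (B.mulPureAux n (Fin.tail g)).1 (fun b x => mul_assoc (B.β b) x (g 0))
        (B.mulPureAux n (Fin.tail g)).2 p ((B.iterΔAux n).1 q)).symm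
      exact congrArg (tmul B.bim (B.cn (n + 1)) (p * g 0)) (ih q (Fin.tail g))
    | ad u v hu hv =>
      rw [map_add, map_add, LinearMap.add_apply, hu, hv]
      exact (map_add (B.mulPureAux (n + 1) g).1 _ _).symm

theorem lastCoface_pure (n : ℕ) (g : Fin (n + 1) → H) :
    B.coface (n + 1) (n + 2) (B.pure n g) = B.pure (n + 1) (Fin.snoc g (1 : H)) := by
  induction n with
  | zero => rfl
  | succ n ih =>
    refine (tensorMap_tmul (M := B.bim) (M' := B.bim) LinearMap.id
      (B.cofaceSucc (n + 1) (n + 1)).1 (IsRightLinear.id B.bim)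
      (B.cofaceSucc (n + 1) (n + 1)).2 (g 0) (B.pure n (Fin.tail g))).trans ?_
    have e : Fin.tail (Fin.snoc g (1 : H) : Fin (n + 3) → H) =
        (Fin.snoc (Fin.tail g) (1 : H) : Fin (n + 2) → H) := by
      ext i
      refine Fin.lastCases ?_ (fun j => ?_) i
      · simp [Fin.tail]
      · simp only [Fin.tail, Fin.snoc_castSucc, Fin.succ_castSucc]
    have e0 : (Fin.snoc g (1 : H) : Fin (n + 3) → H) 0 = g 0 :=
      Fin.snoc_castSucc (α := fun _ => H) (1 : H) g 0
    have h : (B.cofaceSucc (n + 1) (n + 1)).1 (B.pure n (Fin.tail g)) =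
      B.pure (n + 1) (Fin.snoc (Fin.tail g) (1 : H)) := ih (Fin.tail g)
    rw [h, B.pure_succ (n + 1), e, e0]
    rfl

/-! ### Antialgebra maps and the cyclic operator -/

section antipode

variable (T : Hᵐᵒᵖ →ₐ[k] H)

/-- `T`, viewed as a `k`-linear map `H → H`. -/
def lin (T : Hᵐᵒᵖ →ₐ[k] H) : H →ₗ[k] H := T.toLinearMap ∘ₗ (opLinearEquiv k).toLinearMap

@[simp] theorem lin_apply (T : Hᵐᵒᵖ →ₐ[k] H) (h : H) : lin T h = T (op h) := rfl

variable (hT : ∀ r, T (op (B.β (op r))) = B.α r)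

/-- The map `m(T ⊗ id) : H ⊗_R H → H`, `x ⊗ y ↦ T(x) y`; it is well defined when `T β = α`. -/
def mulAnti : tensor B.bim B.bim →ₗ[k] B.bim :=
  tensorLift (M := B.bim) (N := B.bim) (LinearMap.mul k H ∘ₗ lin T) (by
    intro r x y
    simp [hT, mul_assoc])

theorem anti_source (hT : ∀ r, T (op (B.β (op r))) = B.α r) (r : R) (x : H) : T (op (B.β (op r) * x)) = T (op x) * B.α r := by
  rw [op_mul, map_mul, hT]

/-- The map `H ⊗_R H → H ⊗_R H`, `x ⊗ y ↦ Δ(T(x)) · (y ⊗ 1) = T(x)⁽¹⁾ y ⊗ T(x)⁽²⁾`; it is well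
defined when `T β = α`. -/
def twist : tensor B.bim B.bim →ₗ[k] tensor B.bim B.bim :=
  tensorLift (M := B.bim) (N := B.bim)
    (((TensorProduct.mk k H H).flip 1).lcomp k _ ∘ₗ B.rightAct ∘ₗ B.Δ ∘ₗ lin T) (by
    intro r x y
    change B.rightAct (B.Δ (T (op (B.β (op r) * x)))) (y ⊗ₜ 1) =
      B.rightAct (B.Δ (T (op x))) ((B.α r * y) ⊗ₜ 1)
    have key : ∀ a z : H, B.rightAct (B.Δ a) (z ⊗ₜ 1) =
        B.diagStep B.bim (Algebra.lmul k H) B.lmul_source a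
          (tmul B.bim B.bim z (1 : H)) :=
      fun a z => (B.diagStep_tmul B.bim _ _ a z (1 : H)).symm
    rw [B.anti_source T hT, key, key, map_mul, Module.End.mul_apply, diagStep_source]
    rfl)

theorem twist_tmul (x y : H) :
    B.twist T hT (tmul B.bim B.bim x y) = B.rightAct (B.Δ (T (op x))) (y ⊗ₜ 1) :=
  tensorLift_tmul (M := B.bim) (N := B.bim) _ _ x y

theorem tau_balanced (hT : ∀ r, T (op (B.β (op r))) = B.α r) (n : ℕ) (r : R) (x : H) (y : B.cn (n + 1)) :
    B.diag (n + 1) (T (op (B.β (op r) * x))) (B.coface (n + 1) (n + 2) y) =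
      B.diag (n + 1) (T (op x)) (B.coface (n + 1) (n + 2) ((B.cn (n + 1)).left r y)) := by
  change B.diag (n + 1) (T (op (B.β (op r) * x))) ((B.cofaceSucc (n + 1) (n + 1)).1 y) =
    B.diag (n + 1) (T (op x)) ((B.cofaceSucc (n + 1) (n + 1)).1 ((B.cn (n + 1)).left r y))
  rw [B.anti_source T hT, map_mul, Module.End.mul_apply, diag_source,
    (B.cofaceSucc (n + 1) (n + 1)).2]

/-- The cyclic operators: `τ₀ = id` on `H_♮^0 = R`, `τ₁ = T`, and for `n ≥ 2`
`τₙ(h₁ ⊗ ⋯ ⊗ hₙ) = T(h₁) ▷ (h₂ ⊗ ⋯ ⊗ hₙ ⊗ 1) = Δ^{n-1}(T(h₁)) · (h₂ ⊗ ⋯ ⊗ hₙ ⊗ 1)`,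
where `h₂ ⊗ ⋯ ⊗ hₙ ⊗ 1 = δₙ(h₂ ⊗ ⋯ ⊗ hₙ)`; see also `tau_pure`. -/
def tau (hT : ∀ r, T (op (B.β (op r))) = B.α r) : (n : ℕ) → (B.cn n →ₗ[k] B.cn n)
  | 0 => LinearMap.id
  | 1 => (lin T : H →ₗ[k] H)
  | n + 2 => tensorLift (M := B.bim) (N := B.cn (n + 1))
      ((B.coface (n + 1) (n + 2)).lcomp k _ ∘ₗ (B.diag (n + 1)).toLinearMap ∘ₗ lin T)
      (B.tau_balanced T hT n)

theorem tau_tmul (hT : ∀ r, T (op (B.β (op r))) = B.α r) (n : ℕ) (h : H) (x : B.cn (n + 1)) :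
    B.tau T hT (n + 2) (tmul B.bim (B.cn (n + 1)) h x) =
      B.diag (n + 1) (T (op h)) (B.coface (n + 1) (n + 2) x) :=
  tensorLift_tmul (M := B.bim) (N := B.cn (n + 1))
    ((B.coface (n + 1) (n + 2)).lcomp k _ ∘ₗ (B.diag (n + 1)).toLinearMap ∘ₗ lin T)
    (B.tau_balanced T hT n) h x

/-- `τₙ(h₁ ⊗ ⋯ ⊗ hₙ) = Δ^{n-1}(T(h₁)) · (h₂ ⊗ ⋯ ⊗ hₙ ⊗ 1)`, for `n ≥ 1`. -/
theorem tau_pure (hT : ∀ r, T (op (B.β (op r))) = B.α r) (n : ℕ) (h : Fin (n + 1) → H) :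
    B.tau T hT (n + 1) (B.pure n h) =
      B.mulPure n (Fin.snoc (Fin.tail h) (1 : H)) (B.iterΔ n (T (op (h 0)))) := by
  match n with
  | 0 =>
    change T (op (h 0)) = T (op (h 0)) * _
    exact (mul_one _).symm
  | n + 1 =>
    refine (B.tau_tmul T hT n (h 0) (B.pure n (Fin.tail h))).trans ?_
    rw [B.lastCoface_pure, B.diag_pure]

/-- `(H, R, T)` is a para-Hopf algebroid: the antialgebra map `T` is a para-antipode. -/
structure IsParaHopf (T : Hᵐᵒᵖ →ₐ[k] H) : Prop where
  ph1 : ∀ r, T (op (B.β (op r))) = B.α r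
  /-- `m(T ⊗ id)Δ = β ε T`. -/
  ph2 : ∀ h : H, B.mulAnti T ph1 (B.Δ h) = B.β (op (B.ε (T (op h))))
  sq_eq : ∀ h, T (op (T (op h))) = h
  /-- `T(h⁽¹⁾)⁽¹⁾ h⁽²⁾ ⊗ T(h⁽¹⁾)⁽²⁾ = 1 ⊗ T(h)`. -/
  twist_eq : ∀ h : H, B.twist T ph1 (B.Δ h) = tmul B.bim B.bim (1 : H) (T (op h))

end antipode

end Bialgebroid

/-! ### Cocyclic modules -/

/-- `k`-modules `C n`, `n ≥ 0`, with cofaces `δ n i : C n → C (n+1)` (`0 ≤ i ≤ n + 1`),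
codegeneracies `σ n i : C (n+1) → C n` (`0 ≤ i ≤ n`) and cyclic operators `τ n : C n → C n`, form a
cocyclic module. Values of `δ n i`, `σ n i` for other indices `i` play no role. -/
structure IsCocyclic {C : ℕ → Type u} [∀ n, AddCommGroup (C n)] [∀ n, Module k (C n)]
    (δ : (n i : ℕ) → (C n →ₗ[k] C (n + 1))) (σ : (n i : ℕ) → (C (n + 1) →ₗ[k] C n))
    (τ : (n : ℕ) → (C n →ₗ[k] C n)) : Prop where
  δ_δ : ∀ n i j, i ≤ j → j ≤ n + 1 → δ (n + 1) (j + 1) ∘ₗ δ n i = δ (n + 1) i ∘ₗ δ n j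
  σ_σ : ∀ n i j, i ≤ j → j ≤ n → σ n j ∘ₗ σ (n + 1) i = σ n i ∘ₗ σ (n + 1) (j + 1)
  σ_δ_of_lt : ∀ n i j, i ≤ j → j ≤ n → σ (n + 1) (j + 1) ∘ₗ δ (n + 1) i = δ n i ∘ₗ σ n j
  σ_δ_self : ∀ n j, j ≤ n → σ n j ∘ₗ δ n j = LinearMap.id
  σ_δ_succ : ∀ n j, j ≤ n → σ n j ∘ₗ δ n (j + 1) = LinearMap.id
  σ_δ_of_gt : ∀ n i j, j < i → i ≤ n + 1 → σ (n + 1) j ∘ₗ δ (n + 1) (i + 1) = δ n i ∘ₗ σ n j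
  τ_δ_succ : ∀ n i, i ≤ n → τ (n + 1) ∘ₗ δ n (i + 1) = δ n i ∘ₗ τ n
  τ_δ_zero : ∀ n, τ (n + 1) ∘ₗ δ n 0 = δ n (n + 1)
  τ_σ_succ : ∀ n i, i + 1 ≤ n → τ n ∘ₗ σ n (i + 1) = σ n i ∘ₗ τ (n + 1)
  τ_σ_zero : ∀ n, τ n ∘ₗ σ n 0 = σ n n ∘ₗ τ (n + 1) ∘ₗ τ (n + 1)
  τ_pow : ∀ n (x : C n), (τ n)^[n + 1] x = x

end ParaHopf

/-!
Write `a ▷ x` for the diagonal action of `a ∈ H` on `x ∈ H^{⊗_R n}`, given by the iterated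
coproduct.

A cocyclic module gives both conditions on `T` at once: `T² = id` is `τ₁² = id`, and the twist
identity `T(h⁽¹⁾)⁽¹⁾ h⁽²⁾ ⊗ T(h⁽¹⁾)⁽²⁾ = 1 ⊗ T(h)` is `τ₂ δ₁ = δ₀ τ₁`, since `τ₂` is the map `twist`
(`tau_two`).

Conversely, the cosimplicial identities involve only the bialgebroid structure; they hold by
induction on the number of tensor factors, tensoring with `H` on the left (`whisker`) at each step,
from coassociativity and counitality in the first factor. The cyclic relations rest on three facts.

* Linearity for the diagonal action. The inner cofaces commute with `▷` because `Δ` is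
  multiplicative (`diag_cofaceSucc`). For the codegeneracies (`diag_codeg`) one needs
  `ε(ab) = ε(a α(ε(b)))`, which is not among the bialgebroid axioms and does not follow from them:
  on `k[x]/(x²)` with `Δ(x) = x ⊗ x` and `ε(x) = 1` it fails. It follows from the antipode
  (`ε_mul`): `β ε T(gh) = T(h⁽¹⁾) T(g⁽¹⁾) g⁽²⁾ h⁽²⁾` depends on `g` only through `β ε T(g)`, and `T`
  is surjective, being an involution.
* The identity `T(a⁽¹⁾) ▷ ((a⁽²⁾ ▷ z) ⊗ h) = z ⊗ T(a) h` (`antiMap_append`). It is the twist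
  identity spread over several factors by coassociativity (`antiMap_whisker_Δ`).
* Rotation. With `T² = id` the preceding identity gives `τ(T(h) ▷ (g ⊗ z)) = T(g) ▷ (z ⊗ h)`
  (`tau_diag`). So `τₙ` rotates cyclically the `n + 1` entries of
  `T(v₀) ▷ (v₁ ⊗ ⋯ ⊗ vₙ)` (`tau_word`). Every pure tensor has this form with `v₀ = 1`, hence
  `τₙⁿ⁺¹ = id` (`tau_iterate`); the relation `τₙ σ₀ = σₙ τₙ₊₁²` comes from two rotations
  (`tau_codeg_zero`).
-/

namespace ParaHopf

open RBimodule

/-! ### Rotation of tuples -/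

theorem tail_snoc {A : Type*} {n : ℕ} (g : Fin (n + 1) → A) (h : A) :
    Fin.tail (Fin.snoc g h : Fin (n + 2) → A) = (Fin.snoc (Fin.tail g) h : Fin (n + 1) → A) := by
  ext i
  refine Fin.lastCases ?_ (fun j => ?_) i
  · simp [Fin.tail]
  · simp only [Fin.tail, Fin.snoc_castSucc, Fin.succ_castSucc]

theorem snoc_tail_eq_comp_finRotate {A : Type*} {n : ℕ} (v : Fin (n + 1) → A) :
    (Fin.snoc (Fin.tail v) (v 0) : Fin (n + 1) → A) = v ∘ finRotate (n + 1) := by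
  rw [Fin.snoc_eq_cons_rotate]
  ext i
  simp

theorem finRotate_pow (n : ℕ) : finRotate (n + 2) ^ (n + 2) = 1 := by
  have h := (isCycle_finRotate (n := n)).orderOf
  rw [support_finRotate, Finset.card_univ, Fintype.card_fin] at h
  exact orderOf_dvd_iff_pow_eq_one.1 h.dvd

namespace Bialgebroid

variable {k : Type v} {R H : Type u} [CommRing k] [Ring R] [Algebra k R] [Ring H] [Algebra k H]
  (B : Bialgebroid k R H) {N N' P P' : RBimodule k R}

/-! ### Tensoring with `H` on the left -/

/-- The map `id ⊗ f : H ⊗_R N → H ⊗_R N'`, for `f` left linear. -/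
def whisker (f : N →ₗ[k] N') (hf : IsLeftLinear f) : tensor B.bim N →ₗ[k] tensor B.bim N' :=
  tensorMap LinearMap.id f (IsRightLinear.id B.bim) hf

theorem whisker_tmul (f : N →ₗ[k] N') (hf : IsLeftLinear f) (x : H) (y : N) :
    B.whisker f hf (tmul B.bim N x y) = tmul B.bim N' x (f y) :=
  tensorMap_tmul (M := B.bim) (M' := B.bim) LinearMap.id f (IsRightLinear.id B.bim) hf x y

theorem whisker_left (f : N →ₗ[k] N') (hf : IsLeftLinear f) : IsLeftLinear (B.whisker f hf) :=
  isLeftLinear_tensorMap (IsRightLinear.id B.bim) hf (IsLeftLinear.id B.bim)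

/-- The inductive step for the cosimplicial identities: a relation `f g = f' g'` persists after
tensoring with `H` on the left. -/
theorem whisker_comp_eq {f : P →ₗ[k] N'} {g : N →ₗ[k] P} {f' : P' →ₗ[k] N'} {g' : N →ₗ[k] P'}
    (hf : IsLeftLinear f) (hg : IsLeftLinear g) (hf' : IsLeftLinear f') (hg' : IsLeftLinear g')
    (h : f ∘ₗ g = f' ∘ₗ g') :
    B.whisker f hf ∘ₗ B.whisker g hg = B.whisker f' hf' ∘ₗ B.whisker g' hg' :=
  tensor_hom_ext fun (x : H) y => by
    rw [LinearMap.comp_apply, LinearMap.comp_apply, whisker_tmul, whisker_tmul, whisker_tmul,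
      whisker_tmul]
    exact congrArg (tmul B.bim N' x) (LinearMap.congr_fun h y)

theorem whisker_comp_eq_id {f : P →ₗ[k] N} {g : N →ₗ[k] P}
    (hf : IsLeftLinear f) (hg : IsLeftLinear g) (h : f ∘ₗ g = LinearMap.id) :
    B.whisker f hf ∘ₗ B.whisker g hg = LinearMap.id :=
  tensor_hom_ext fun (x : H) y => by
    rw [LinearMap.comp_apply, whisker_tmul, whisker_tmul]
    exact congrArg (tmul B.bim N x) (LinearMap.congr_fun h y)

/-- The map `Δ ⊗ id : H ⊗_R N → H ⊗_R (H ⊗_R N)`. -/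
def comulFirst (N : RBimodule k R) : tensor B.bim N →ₗ[k] tensor B.bim (tensor B.bim N) :=
  assoc B.bim B.bim N ∘ₗ tensorMap B.Δ LinearMap.id B.Δ_right (IsLeftLinear.id N)

/-- The map `ε ⊗ id : H ⊗_R N → N`. -/
def counitFirst (N : RBimodule k R) : tensor B.bim N →ₗ[k] N :=
  leftUnit N ∘ₗ tensorMap B.ε LinearMap.id B.ε_right (IsLeftLinear.id N)

theorem comulFirst_left : IsLeftLinear (B.comulFirst N) :=
  isLeftLinear_assoc.comp (isLeftLinear_tensorMap B.Δ_right (IsLeftLinear.id N) B.Δ_left)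

theorem counitFirst_left : IsLeftLinear (B.counitFirst N) :=
  isLeftLinear_leftUnit.comp (isLeftLinear_tensorMap B.ε_right (IsLeftLinear.id N) B.ε_left)

theorem comulFirst_tmul (x : H) (y : N) :
    B.comulFirst N (tmul B.bim N x y) =
      assoc B.bim B.bim N (tmul (tensor B.bim B.bim) N (B.Δ x) y) :=
  congrArg (assoc B.bim B.bim N)
    (tensorMap_tmul B.Δ LinearMap.id B.Δ_right (IsLeftLinear.id N) x y)

theorem counitFirst_tmul (x : H) (y : N) :
    B.counitFirst N (tmul B.bim N x y) = N.left (B.ε x) y :=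
  (congrArg (leftUnit N)
    (tensorMap_tmul B.ε LinearMap.id B.ε_right (IsLeftLinear.id N) x y)).trans
    (leftUnit_tmul _ _)

/-- The map `H ⊗_R N → H ⊗_R N'`, `p ⊗ y ↦ p x ⊗ f y`, for `f` left linear. -/
def mulMap (x : H) (f : N →ₗ[k] N') (hf : IsLeftLinear f) :
    tensor B.bim N →ₗ[k] tensor B.bim N' :=
  tensorMap (M := B.bim) (M' := B.bim) (LinearMap.mulRight k x) f
    (fun b z => mul_assoc (B.β b) z x) hf

theorem mulMap_tmul (x : H) (f : N →ₗ[k] N') (hf : IsLeftLinear f) (p : H) (y : N) :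
    B.mulMap x f hf (tmul B.bim N p y) = tmul B.bim N' (p * x) (f y) :=
  tensorMap_tmul (M := B.bim) (M' := B.bim) (LinearMap.mulRight k x) f
    (fun b z => mul_assoc (B.β b) z x) hf p y

theorem mulMap_left (x : H) (f : N →ₗ[k] N') (hf : IsLeftLinear f) :
    IsLeftLinear (B.mulMap x f hf) :=
  isLeftLinear_tensorMap (M := B.bim) (M' := B.bim) (fun b z => mul_assoc (B.β b) z x) hf
    (fun a z => mul_assoc (B.α a) z x)

/-- Naturality of the associator in the last factor. -/
theorem assoc_tensorMap_tmul (f : N →ₗ[k] N') (hf : IsLeftLinear f) (u : tensor B.bim B.bim)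
    (y : N) : B.whisker (B.whisker f hf) (B.whisker_left f hf)
        (assoc B.bim B.bim N (tmul (tensor B.bim B.bim) N u y)) =
      assoc B.bim B.bim N' (tmul (tensor B.bim B.bim) N' u (f y)) := by
  induction u using tensorInduction with
  | tm p q =>
    rw [assoc_tmul, assoc_tmul, whisker_tmul, whisker_tmul]
  | ad a b ha hb => simp only [map_add, LinearMap.add_apply, ha, hb]

theorem whisker_whisker_comulFirst (f : N →ₗ[k] N') (hf : IsLeftLinear f) :
    B.whisker (B.whisker f hf) (B.whisker_left f hf) ∘ₗ B.comulFirst N =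
      B.comulFirst N' ∘ₗ B.whisker f hf :=
  tensor_hom_ext fun (x : H) y => by
    rw [LinearMap.comp_apply, LinearMap.comp_apply, comulFirst_tmul, whisker_tmul,
      comulFirst_tmul, assoc_tensorMap_tmul]

theorem counitFirst_whisker (f : N →ₗ[k] N') (hf : IsLeftLinear f) :
    B.counitFirst N' ∘ₗ B.whisker f hf = f ∘ₗ B.counitFirst N :=
  tensor_hom_ext fun (x : H) y => by
    rw [LinearMap.comp_apply, LinearMap.comp_apply, counitFirst_tmul, whisker_tmul,
      counitFirst_tmul, hf]

/-- Coassociativity, tensored with `N` on the right. -/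
theorem comulFirst_comulFirst :
    B.comulFirst (tensor B.bim N) ∘ₗ B.comulFirst N =
      B.whisker (B.comulFirst N) B.comulFirst_left ∘ₗ B.comulFirst N :=
  tensor_hom_ext fun (x : H) y => by
    -- `p ⊗ (q ⊗ s) ↦ p ⊗ (q ⊗ (s ⊗ y))`, applied to the two sides of coassociativity
    let g : B.bim →ₗ[k] tensor B.bim N := (tmul B.bim N).flip y
    have hg : IsLeftLinear g := fun a z => rfl
    let F := B.whisker (B.whisker g hg) (B.whisker_left g hg)
    have e := congrArg F (B.coassoc x)
    rw [LinearMap.comp_apply, LinearMap.comp_apply, comulFirst_tmul]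
    refine Eq.trans ?_ (e.trans ?_)
    · generalize B.Δ x = u
      induction u using tensorInduction with
      | tm p q =>
        rw [assoc_tmul, comulFirst_tmul, tensorMap_tmul]
        exact (B.assoc_tensorMap_tmul g hg (B.Δ p) q).symm
      | ad a b ha hb => simp only [map_add, LinearMap.add_apply, ha, hb]
    · generalize B.Δ x = u
      induction u using tensorInduction with
      | tm p q =>
        rw [assoc_tmul, whisker_tmul, tensorMap_tmul, comulFirst_tmul]
        refine (B.whisker_tmul _ _ _ _).trans (congrArg (tmul B.bim _ p) ?_)
        generalize B.Δ q = w
        induction w using tensorInduction with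
        | tm p q => exact (B.whisker_tmul _ _ _ _).trans (assoc_tmul _ _ _).symm
        | ad a b ha hb => simp only [map_add, LinearMap.add_apply, ha, hb]
      | ad a b ha hb => simp only [map_add, LinearMap.add_apply, ha, hb]

theorem counitFirst_comulFirst :
    B.counitFirst (tensor B.bim N) ∘ₗ B.comulFirst N = LinearMap.id :=
  tensor_hom_ext fun (x : H) y => by
    rw [LinearMap.comp_apply, comulFirst_tmul]
    refine Eq.trans ?_ (congrArg (fun z : H => tmul B.bim N z y) (B.counit_left x))
    generalize B.Δ x = u
    induction u using tensorInduction with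
    | tm p q =>
      rw [assoc_tmul, counitFirst_tmul, tensorMap_tmul, leftUnit_tmul]
      rfl
    | ad a b ha hb => simp only [map_add, LinearMap.add_apply, ha, hb]

theorem whisker_counitFirst_comulFirst :
    B.whisker (B.counitFirst N) B.counitFirst_left ∘ₗ B.comulFirst N = LinearMap.id :=
  tensor_hom_ext fun (x : H) y => by
    rw [LinearMap.comp_apply, comulFirst_tmul]
    refine Eq.trans ?_ (congrArg (fun z : H => tmul B.bim N z y) (B.counit_right x))
    generalize B.Δ x = u
    induction u using tensorInduction with
    | tm p q =>
      rw [assoc_tmul, whisker_tmul, tensorMap_tmul, rightUnit_tmul, counitFirst_tmul]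
      exact (balanced (M := B.bim) _ _ _).symm
    | ad a b ha hb => simp only [map_add, LinearMap.add_apply, ha, hb]

/-- The map `id ⊗ ε : H ⊗_R H → H`. -/
def counitLast : tensor B.bim B.bim →ₗ[k] B.bim :=
  rightUnit B.bim ∘ₗ tensorMap LinearMap.id B.ε (IsRightLinear.id B.bim) B.ε_left

theorem counitLast_tmul (x y : H) :
    B.counitLast (tmul B.bim B.bim x y) = B.β (op (B.ε y)) * x :=
  (congrArg (rightUnit B.bim)
    (tensorMap_tmul LinearMap.id B.ε (IsRightLinear.id B.bim) B.ε_left x y)).trans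
    (rightUnit_tmul (M := B.bim) _ _)

theorem counitLast_left : IsLeftLinear B.counitLast :=
  isLeftLinear_rightUnit.comp
    (isLeftLinear_tensorMap (IsRightLinear.id B.bim) B.ε_left (IsLeftLinear.id B.bim))

theorem counitLast_Δ : B.counitLast ∘ₗ B.Δ = LinearMap.id := LinearMap.ext B.counit_right

theorem counitFirst_Δ : B.counitFirst B.bim ∘ₗ B.Δ = LinearMap.id := LinearMap.ext B.counit_left

theorem Δ_target (r : R) : B.Δ (B.β (op r)) = tmul B.bim B.bim (1 : H) (B.β (op r)) := by
  have h := B.Δ_right (op r) (1 : H)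
  rw [B.Δ_one, tensor_right_tmul] at h
  simpa using h

theorem ε_source (r : R) : B.ε (B.α r) = r := by
  have h := B.ε_left r (1 : H)
  rw [B.ε_one] at h
  simpa using h

theorem ε_target (r : R) : B.ε (B.β (op r)) = r := by
  have h := B.ε_right (op r) (1 : H)
  rw [B.ε_one] at h
  simpa using h

theorem target_injective {r s : R} (h : B.β (op r) = B.β (op s)) : r = s := by
  rw [← B.ε_target r, h, B.ε_target]

theorem tmul_one_target (r : R) : tmul B.bim B.bim (B.β (op r)) (1 : H) =
    tmul B.bim B.bim (1 : H) (B.α r) := by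
  simpa using balanced (M := B.bim) (N := B.bim) r (1 : H) (1 : H)

/-! ### The cosimplicial identities -/

theorem comulFirst_unitTensor :
    B.comulFirst N ∘ₗ B.unitTensor N = B.unitTensor (tensor B.bim N) ∘ₗ B.unitTensor N :=
  LinearMap.ext fun y => by
    change B.comulFirst N (tmul B.bim N (1 : H) y) = _
    rw [comulFirst_tmul, B.Δ_one, assoc_tmul]
    rfl

theorem counitFirst_unitTensor : B.counitFirst N ∘ₗ B.unitTensor N = LinearMap.id :=
  LinearMap.ext fun y => by
    change B.counitFirst N (tmul B.bim N (1 : H) y) = _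
    rw [counitFirst_tmul, B.ε_one, map_one]
    rfl

theorem whisker_unitTensor (f : N →ₗ[k] N') (hf : IsLeftLinear f) :
    B.whisker f hf ∘ₗ B.unitTensor N = B.unitTensor N' ∘ₗ f :=
  LinearMap.ext fun y => B.whisker_tmul f hf 1 y

theorem coface_succ (n i : ℕ) : B.coface n (i + 1) = (B.cofaceSucc n i).1 := by
  cases n <;> rfl

theorem cofaceSucc_cofaceSucc : ∀ n i j, i ≤ j → j ≤ n →
    (B.cofaceSucc (n + 1) (j + 1)).1 ∘ₗ (B.cofaceSucc n i).1 =
      (B.cofaceSucc (n + 1) i).1 ∘ₗ (B.cofaceSucc n j).1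
  | 0, 0, 0, _, _ => LinearMap.ext fun r => (B.Δ_source r).symm
  | 0, _, j + 1, _, hj => absurd hj (by omega)
  | 0, i + 1, 0, hij, _ => absurd hij (by omega)
  | 1, 0, 0, _, _ => LinearMap.ext fun h => (B.coassoc h).symm
  | 1, 0, 1, _, _ => LinearMap.ext fun (h : H) => by
    change B.whisker B.tensorUnit B.tensorUnit_left (B.Δ h) =
      B.comulFirst B.bim (tmul B.bim B.bim h (1 : H))
    rw [comulFirst_tmul]
    generalize B.Δ h = u
    induction u using tensorInduction with
    | tm p q => exact (B.whisker_tmul _ _ _ _).trans (assoc_tmul _ _ _).symm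
    | ad a b ha hb => simp only [map_add, LinearMap.add_apply, ha, hb]
  | 1, 1, 1, _, _ => LinearMap.ext fun (h : H) => by
    change B.whisker B.tensorUnit B.tensorUnit_left (tmul B.bim B.bim h (1 : H)) =
      B.whisker B.Δ B.Δ_left (tmul B.bim B.bim h (1 : H))
    rw [whisker_tmul, whisker_tmul]
    exact congrArg _ B.Δ_one.symm
  | 1, i + 1, 0, hij, _ => absurd hij (by omega)
  | 1, i + 2, 1, hij, _ => absurd hij (by omega)
  | 1, _, j + 2, _, hj => absurd hj (by omega)
  | n + 2, 0, 0, _, _ => B.comulFirst_comulFirst.symm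
  | n + 2, 0, j + 1, _, _ => B.whisker_whisker_comulFirst (B.cofaceSucc (n + 1) j).1
    (B.cofaceSucc (n + 1) j).2
  | n + 2, i + 1, j + 1, hij, hj => B.whisker_comp_eq
    (B.cofaceSucc (n + 2) (j + 1)).2 (B.cofaceSucc (n + 1) i).2
    (B.cofaceSucc (n + 2) i).2 (B.cofaceSucc (n + 1) j).2
    (cofaceSucc_cofaceSucc (n + 1) i j (by omega) (by omega))

theorem codeg_codeg : ∀ n i j, i ≤ j → j ≤ n →
    B.codeg n j ∘ₗ B.codeg (n + 1) i = B.codeg n i ∘ₗ B.codeg (n + 1) (j + 1)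
  | 0, 0, 0, _, _ => tensor_hom_ext fun (x y : H) => by
    change B.ε (B.counitFirst B.bim (tmul B.bim B.bim x y)) =
      B.ε (B.counitLast (tmul B.bim B.bim x y))
    rw [counitFirst_tmul, counitLast_tmul, B.ε_left]
    exact (B.ε_right (op (B.ε y)) x).symm
  | 0, _, j + 1, _, hj => absurd hj (by omega)
  | 0, i + 1, 0, hij, _ => absurd hij (by omega)
  | n + 1, 0, 0, _, _ =>
    (B.counitFirst_whisker (N' := B.cn (n + 1)) (B.counitFirst (B.cn (n + 1)))
      B.counitFirst_left).symm
  | n + 1, 0, j + 1, _, _ =>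
    (B.counitFirst_whisker (B.codegAux (n + 1) (j + 1)).1 (B.codegAux (n + 1) (j + 1)).2).symm
  | 1, i + 1, j + 1, hij, hj => congrArg (rightUnit B.bim ∘ₗ ·)
    (B.whisker_comp_eq B.ε_left (B.codegAux 1 i).2 B.ε_left (B.codegAux 1 (j + 1)).2
      (codeg_codeg 0 i j (by omega) (by omega)))
  | n + 2, i + 1, j + 1, hij, hj => B.whisker_comp_eq
    (B.codegAux (n + 1) j).2 (B.codegAux (n + 2) i).2
    (B.codegAux (n + 1) i).2 (B.codegAux (n + 2) (j + 1)).2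
    (codeg_codeg (n + 1) i j (by omega) (by omega))

theorem codeg_cofaceSucc_of_lt : ∀ n i j, i ≤ j → j ≤ n →
    B.codeg (n + 2) (j + 2) ∘ₗ (B.cofaceSucc (n + 2) i).1 =
      (B.cofaceSucc (n + 1) i).1 ∘ₗ B.codeg (n + 1) (j + 1)
  | 0, 0, 0, _, _ => tensor_hom_ext fun (x y : H) => by
    change B.whisker B.counitLast B.counitLast_left
      (B.comulFirst B.bim (tmul B.bim B.bim x y)) = B.Δ (B.counitLast (tmul B.bim B.bim x y))
    rw [comulFirst_tmul, counitLast_tmul]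
    refine Eq.trans ?_ (B.Δ_right (op (B.ε y)) x).symm
    generalize B.Δ x = u
    induction u using tensorInduction with
    | tm p q =>
      rw [assoc_tmul, whisker_tmul, counitLast_tmul]
      rfl
    | ad a b ha hb => simp only [map_add, LinearMap.add_apply, ha, hb]
  | 0, _, j + 1, _, hj => absurd hj (by omega)
  | 0, i + 1, 0, hij, _ => absurd hij (by omega)
  | n + 1, 0, j, _, _ =>
    B.whisker_whisker_comulFirst (B.codegAux (n + 1) j).1 (B.codegAux (n + 1) j).2
  | n + 1, i + 1, j + 1, hij, hj => B.whisker_comp_eq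
    (B.codegAux (n + 2) (j + 2)).2 (B.cofaceSucc (n + 2) i).2
    (B.cofaceSucc (n + 1) i).2 (B.codegAux (n + 1) (j + 1)).2
    (codeg_cofaceSucc_of_lt n i j (by omega) (by omega))

theorem codeg_succ_cofaceSucc : ∀ n j, j ≤ n →
    B.codeg (n + 1) (j + 1) ∘ₗ (B.cofaceSucc (n + 1) j).1 = LinearMap.id
  | 0, 0, _ => B.counitLast_Δ
  | 0, j + 1, hj => absurd hj (by omega)
  | n + 1, 0, _ => B.whisker_counitFirst_comulFirst
  | n + 1, j + 1, hj => B.whisker_comp_eq_id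
    (B.codegAux (n + 1) (j + 1)).2 (B.cofaceSucc (n + 1) j).2
    (codeg_succ_cofaceSucc n j (by omega))

theorem codeg_cofaceSucc_self : ∀ n j, j ≤ n →
    B.codeg n j ∘ₗ (B.cofaceSucc n j).1 = LinearMap.id
  | 0, 0, _ => LinearMap.ext B.ε_source
  | 0, j + 1, hj => absurd hj (by omega)
  | 1, 0, _ => B.counitFirst_Δ
  | 1, 1, _ => LinearMap.ext fun (h : H) => by
    change B.counitLast (tmul B.bim B.bim h (1 : H)) = h
    rw [counitLast_tmul, B.ε_one, op_one, map_one, one_mul]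
  | 1, j + 2, hj => absurd hj (by omega)
  | n + 2, 0, _ => B.counitFirst_comulFirst
  | n + 2, j + 1, hj => B.whisker_comp_eq_id
    (B.codegAux (n + 1) j).2 (B.cofaceSucc (n + 1) j).2
    (codeg_cofaceSucc_self (n + 1) j (by omega))

theorem codeg_cofaceSucc_of_gt : ∀ n i j, j ≤ i → i ≤ n →
    B.codeg (n + 1) j ∘ₗ (B.cofaceSucc (n + 1) (i + 1)).1 =
      (B.cofaceSucc n i).1 ∘ₗ B.codeg n j
  | 0, 0, 0, _, _ => LinearMap.ext fun (h : H) => by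
    change B.counitFirst B.bim (tmul B.bim B.bim h (1 : H)) = B.α (B.ε h)
    rw [counitFirst_tmul]
    exact mul_one _
  | 0, i + 1, _, _, hi => absurd hi (by omega)
  | n + 1, i, 0, _, _ => B.counitFirst_whisker (B.cofaceSucc (n + 1) i).1 (B.cofaceSucc (n + 1) i).2
  | 1, 1, 1, _, _ => tensor_hom_ext fun (x y : H) => by
    change B.whisker (B.counitFirst B.bim) B.counitFirst_left
      (B.whisker B.tensorUnit B.tensorUnit_left (tmul B.bim B.bim x y)) =
      tmul B.bim B.bim (B.counitLast (tmul B.bim B.bim x y)) (1 : H)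
    rw [whisker_tmul, whisker_tmul, counitLast_tmul]
    refine Eq.trans (congrArg (tmul B.bim B.bim x) (B.counitFirst_tmul (N := B.bim) y (1 : H))) ?_
    exact (balanced (M := B.bim) (N := B.bim) (B.ε y) x (1 : H)).symm
  | 1, 0, j + 1, hij, _ => absurd hij (by omega)
  | 1, 1, j + 2, hij, _ => absurd hij (by omega)
  | 1, i + 2, _, _, hi => absurd hi (by omega)
  | n + 2, i + 1, j + 1, hij, hi => B.whisker_comp_eq
    (B.codegAux (n + 2) j).2 (B.cofaceSucc (n + 2) (i + 1)).2
    (B.cofaceSucc (n + 1) i).2 (B.codegAux (n + 1) j).2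
    (codeg_cofaceSucc_of_gt (n + 1) i j (by omega) (by omega))

theorem coface_coface : ∀ n i j, i ≤ j → j ≤ n + 1 →
    B.coface (n + 1) (j + 1) ∘ₗ B.coface n i = B.coface (n + 1) i ∘ₗ B.coface n j
  | 0, 0, 0, _, _ => LinearMap.ext fun r => B.Δ_target r
  | 0, 0, 1, _, _ => LinearMap.ext fun r => B.tmul_one_target r
  | 0, 0, j + 2, _, hj => absurd hj (by omega)
  | n + 1, 0, 0, _, _ => B.comulFirst_unitTensor
  | n + 1, 0, j + 1, _, _ =>
    B.whisker_unitTensor (B.cofaceSucc (n + 1) j).1 (B.cofaceSucc (n + 1) j).2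
  | n, i + 1, j + 1, hij, hj => by
    rw [coface_succ, coface_succ, coface_succ, coface_succ]
    exact B.cofaceSucc_cofaceSucc n i j (by omega) (by omega)

theorem codeg_coface_of_lt : ∀ n i j, i ≤ j → j ≤ n →
    B.codeg (n + 1) (j + 1) ∘ₗ B.coface (n + 1) i = B.coface n i ∘ₗ B.codeg n j
  | 0, 0, j, _, hj => LinearMap.ext fun (h : H) =>
    (B.counitLast_tmul 1 h).trans (mul_one _)
  | n + 1, 0, j, _, _ => B.whisker_unitTensor (B.codegAux (n + 1) j).1 (B.codegAux (n + 1) j).2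
  | n + 1, i + 1, j + 1, hij, hj => B.codeg_cofaceSucc_of_lt n i j (by omega) (by omega)
  | 0, i + 1, j, hij, hj => absurd hj (by omega)

theorem codeg_coface_self : ∀ n j, j ≤ n → B.codeg n j ∘ₗ B.coface n j = LinearMap.id
  | 0, 0, _ => LinearMap.ext fun r => B.ε_target r
  | n + 1, 0, _ => B.counitFirst_unitTensor
  | 0, j + 1, hj => absurd hj (by omega)
  | n + 1, j + 1, hj => B.codeg_succ_cofaceSucc n j (by omega)

/-! ### Linearity for the diagonal action -/

section action

variable (ρ : H →ₐ[k] Module.End k N) (hρ : ∀ r, ρ (B.α r) = N.left r)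
  (ρ' : H →ₐ[k] Module.End k N') (hρ' : ∀ r, ρ' (B.α r) = N'.left r)

/-- The orbit map `a ↦ ρ(a) y`. -/
def orbit (y : N) : B.bim →ₗ[k] N := ρ.toLinearMap.flip y

theorem orbit_apply (y : N) (a : H) : B.orbit ρ y a = ρ a y := rfl

theorem orbit_left (hρ : ∀ r, ρ (B.α r) = N.left r) (y : N) : IsLeftLinear (B.orbit ρ y) :=
  fun a z => by
    change ρ (B.α a * z) y = N.left a (ρ z y)
    rw [map_mul, hρ, Module.End.mul_apply]

/-- `(p ⊗ q) · (x ⊗ y) = p x ⊗ ρ(q) y`, as a map in `p ⊗ q`. -/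
theorem act_eq_mulMap (u : tensor B.bim B.bim) (x : H) (y : N) :
    B.act N ρ hρ u (x ⊗ₜ y) = B.mulMap x (B.orbit ρ y) (B.orbit_left ρ hρ y) u := by
  induction u using tensorInduction with
  | tm p q => rw [mulMap_tmul]; exact B.act_tmul N ρ hρ p q x y
  | ad a b ha hb => simp only [map_add, LinearMap.add_apply, ha, hb]

theorem diagStep_eq_mulMap (a x : H) (y : N) :
    B.diagStep N ρ hρ a (tmul B.bim N x y) =
      B.mulMap x (B.orbit ρ y) (B.orbit_left ρ hρ y) (B.Δ a) :=
  (B.diagStep_tmul N ρ hρ a x y).trans (B.act_eq_mulMap ρ hρ _ x y)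

/-- `a ▷ Δ(b) = Δ(ab)`. -/
theorem diagStep_Δ (a b : H) :
    B.diagStep B.bim (Algebra.lmul k H) B.lmul_source a (B.Δ b) = B.Δ (a * b) := by
  obtain ⟨w, hw⟩ := proj_surjective (M := B.bim) (N := B.bim) (B.Δ b)
  rw [B.Δ_mul a b w hw, ← hw]
  clear hw
  induction w with
  | zero => simp
  | tmul c d => exact B.diagStep_tmul B.bim _ _ a c d
  | add c d hc hd => simp only [map_add, hc, hd]

theorem diagStep_whisker (f : N →ₗ[k] N') (hf : IsLeftLinear f)
    (hfρ : ∀ a y, f (ρ a y) = ρ' a (f y)) (a : H) (z : tensor B.bim N) :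
    B.whisker f hf (B.diagStep N ρ hρ a z) = B.diagStep N' ρ' hρ' a (B.whisker f hf z) := by
  induction z using tensorInduction with
  | tm x y =>
    rw [whisker_tmul, diagStep_eq_mulMap, diagStep_eq_mulMap]
    generalize B.Δ a = u
    induction u using tensorInduction with
    | tm p q => rw [mulMap_tmul, mulMap_tmul, whisker_tmul, orbit_apply, orbit_apply, hfρ]
    | ad a b ha hb => simp only [map_add, ha, hb]
  | ad a b ha hb => simp only [map_add, ha, hb]

/-- `Δ ⊗ id` commutes with the diagonal action, by coassociativity and multiplicativity of `Δ`. -/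
theorem diagStep_comulFirst (a : H) (z : tensor B.bim N) :
    B.comulFirst N (B.diagStep N ρ hρ a z) =
      B.diagStep (tensor B.bim N) (B.diagStep N ρ hρ) (B.diagStep_source N ρ hρ) a
        (B.comulFirst N z) := by
  induction z using tensorInduction with
  | tm x y =>
    obtain ⟨w, hw⟩ := proj_surjective (M := B.bim) (N := B.bim) (B.Δ x)
    -- a presentation `Δ(x) = ∑ c ⊗ d` makes `Δ(p x) = ∑ Δ(p) · (c ⊗ d)` usable as `p` varies
    obtain ⟨S, rfl⟩ := TensorProduct.exists_finset w
    have hΔ : B.Δ x = ∑ i ∈ S, tmul B.bim B.bim i.1 i.2 := by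
      rw [← hw, map_sum]
      rfl
    have hf := B.orbit_left ρ hρ y
    -- `p ⊗ (q ⊗ s) ↦ p c ⊗ (q d ⊗ s y)`, to be applied to the two sides of coassociativity
    let F (c d : H) : tensor B.bim (tensor B.bim B.bim) →ₗ[k] tensor B.bim (tensor B.bim N) :=
      B.mulMap c (B.mulMap d (B.orbit ρ y) hf) (B.mulMap_left d _ hf)
    have hF (c d : H) (u : tensor B.bim B.bim) (q : H) :
        F c d (assoc B.bim B.bim B.bim (tmul (tensor B.bim B.bim) B.bim u q)) =
          assoc B.bim B.bim N (tmul (tensor B.bim B.bim) N (B.rightAct u (c ⊗ₜ d)) (ρ q y)) := by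
      induction u using tensorInduction with
      | tm p p' =>
        rw [assoc_tmul]
        refine (B.mulMap_tmul _ _ _ _ _).trans ?_
        rw [mulMap_tmul]
        refine Eq.trans ?_ (congrArg (fun v => assoc B.bim B.bim N
          (tmul (tensor B.bim B.bim) N v (ρ q y))) (B.rightAct_tmul p p' c d)).symm
        exact (assoc_tmul _ _ _).symm
      | ad a b ha hb => simp only [map_add, LinearMap.add_apply, ha, hb]
    rw [diagStep_eq_mulMap, comulFirst_tmul, hΔ]
    simp only [map_sum, LinearMap.sum_apply]
    trans ∑ i ∈ S, F i.1 i.2 (assoc B.bim B.bim B.bim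
      (tensorMap B.Δ LinearMap.id B.Δ_right (IsLeftLinear.id _) (B.Δ a)))
    · generalize B.Δ a = u
      induction u using tensorInduction with
      | tm p q =>
        rw [mulMap_tmul, comulFirst_tmul, B.Δ_mul p x _ hw, tensorMap_tmul]
        simp only [map_sum, LinearMap.sum_apply]
        exact Finset.sum_congr rfl fun i _ => (hF i.1 i.2 (B.Δ p) q).symm
      | ad a b ha hb => simp only [map_add, ha, hb, Finset.sum_add_distrib]
    · rw [B.coassoc]
      refine Finset.sum_congr rfl fun i _ => ?_
      rw [assoc_tmul, diagStep_eq_mulMap]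
      generalize B.Δ a = u
      induction u using tensorInduction with
      | tm p q =>
        rw [tensorMap_tmul, mulMap_tmul]
        refine Eq.trans ?_ (B.mulMap_tmul (N := B.bim) _ _ _ _ _).symm
        rw [orbit_apply, diagStep_eq_mulMap]
        rfl
      | ad a b ha hb => simp only [map_add, ha, hb]
  | ad a b ha hb => simp only [map_add, ha, hb]

theorem counitFirst_diagStep_one (a : H) (y : N) :
    B.counitFirst N (B.diagStep N ρ hρ a (tmul B.bim N (1 : H) y)) = ρ a y := by
  rw [diagStep_eq_mulMap]
  refine Eq.trans ?_ (congrArg (B.orbit ρ y) (B.counit_left a))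
  generalize B.Δ a = u
  induction u using tensorInduction with
  | tm p q =>
    rw [mulMap_tmul, counitFirst_tmul, mul_one, tensorMap_tmul, leftUnit_tmul,
      B.orbit_left ρ hρ y]
    rfl
  | ad a b ha hb => simp only [map_add, ha, hb]

/-- `ε ⊗ id` commutes with the diagonal action. By `hε` one may replace `x` by `α(ε(x))` in `x ⊗ y`,
which is `α(ε(x)) ▷ (1 ⊗ y)`; the claim is then counitality. -/
theorem counitFirst_diagStep (hε : ∀ a b : H, B.ε (a * b) = B.ε (a * B.α (B.ε b))) (a : H)
    (z : tensor B.bim N) :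
    B.counitFirst N (B.diagStep N ρ hρ a z) = ρ a (B.counitFirst N z) := by
  induction z using tensorInduction with
  | tm x y =>
    have e : B.counitFirst N (B.diagStep N ρ hρ a (tmul B.bim N x y)) =
        B.counitFirst N (B.diagStep N ρ hρ a (tmul B.bim N (B.α (B.ε x)) y)) := by
      rw [diagStep_eq_mulMap, diagStep_eq_mulMap]
      generalize B.Δ a = u
      induction u using tensorInduction with
      | tm p q => rw [mulMap_tmul, mulMap_tmul, counitFirst_tmul, counitFirst_tmul, hε]
      | ad a b ha hb => simp only [map_add, ha, hb]
    have e' : tmul B.bim N (B.α (B.ε x)) y =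
        B.diagStep N ρ hρ (B.α (B.ε x)) (tmul B.bim N (1 : H) y) := by
      rw [diagStep_source, tensor_left_tmul]
      exact congrArg (fun z : H => tmul B.bim N z y) (mul_one _).symm
    rw [e, e', ← Module.End.mul_apply, ← map_mul, counitFirst_diagStep_one, counitFirst_tmul,
      map_mul, hρ, Module.End.mul_apply]
  | ad a b ha hb => simp only [map_add, ha, hb]

theorem counitLast_diagStep_one (a b : H) :
    B.counitLast (B.diagStep B.bim (Algebra.lmul k H) B.lmul_source a
      (tmul B.bim B.bim b (1 : H))) = a * b := by
  rw [diagStep_eq_mulMap]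
  refine Eq.trans ?_ (congrArg (LinearMap.mulRight k b) (B.counit_right a))
  generalize B.Δ a = u
  induction u using tensorInduction with
  | tm p q =>
    rw [mulMap_tmul, counitLast_tmul, tensorMap_tmul, rightUnit_tmul]
    change B.β (op (B.ε (q * 1 : H))) * (p * b) = B.β (op (B.ε q)) * p * b
    rw [mul_one, mul_assoc]
  | ad a b ha hb => simp only [map_add, ha, hb]

/-- `id ⊗ ε` commutes with the diagonal action. By `hε` one may replace `y` by `α(ε(y))` in `x ⊗ y`,
which is `β(ε(y)) x ⊗ 1`; the claim is then counitality. -/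
theorem counitLast_diagStep (hε : ∀ a b : H, B.ε (a * b) = B.ε (a * B.α (B.ε b))) (a : H)
    (z : tensor B.bim B.bim) :
    B.counitLast (B.diagStep B.bim (Algebra.lmul k H) B.lmul_source a z) =
      a * B.counitLast z := by
  induction z using tensorInduction with
  | tm x y =>
    have e : B.counitLast (B.diagStep B.bim (Algebra.lmul k H) B.lmul_source a
          (tmul B.bim B.bim x y)) =
        B.counitLast (B.diagStep B.bim (Algebra.lmul k H) B.lmul_source a
          (tmul B.bim B.bim x (B.α (B.ε y)))) := by
      rw [diagStep_eq_mulMap, diagStep_eq_mulMap]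
      generalize B.Δ a = u
      induction u using tensorInduction with
      | tm p q =>
        rw [mulMap_tmul, mulMap_tmul, counitLast_tmul, counitLast_tmul]
        exact congrArg (fun r => B.β (op r) * (p * x)) (hε q y)
      | ad a b ha hb => simp only [map_add, ha, hb]
    have e' : tmul B.bim B.bim x (B.α (B.ε y)) =
        tmul B.bim B.bim (B.β (op (B.ε y)) * x) (1 : H) := by
      simpa using (balanced (M := B.bim) (N := B.bim) (B.ε y) x (1 : H)).symm
    rw [e, e', counitLast_diagStep_one, counitLast_tmul]
  | ad a b ha hb => simp only [map_add, ha, hb, mul_add]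

end action

/-- The cofaces `δ_i`, `1 ≤ i ≤ n`, of `H_♮^n` commute with the diagonal action. -/
theorem diag_cofaceSucc : ∀ n i, i ≤ n → ∀ (a : H) (x : B.cn (n + 1)),
    (B.cofaceSucc (n + 1) i).1 (B.diag n a x) =
      B.diag (n + 1) a ((B.cofaceSucc (n + 1) i).1 x)
  | 0, 0, _, a, x => (B.diagStep_Δ a x).symm
  | 0, i + 1, hi, _, _ => absurd hi (by omega)
  | n + 1, 0, _, a, x => B.diagStep_comulFirst (B.diag n) (B.diag_source n) a x
  | n + 1, i + 1, hi, a, x => B.diagStep_whisker (B.diag n) (B.diag_source n)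
      (B.diag (n + 1)) (B.diag_source (n + 1)) (B.cofaceSucc (n + 1) i).1
      (B.cofaceSucc (n + 1) i).2 (diag_cofaceSucc n i (by omega)) a x

/-- The codegeneracies `H_♮^{n+2} → H_♮^{n+1}` commute with the diagonal action. -/
theorem diag_codeg (hε : ∀ a b : H, B.ε (a * b) = B.ε (a * B.α (B.ε b))) :
    ∀ n i, i ≤ n + 1 → ∀ (a : H) (x : B.cn (n + 2)),
    B.codeg (n + 1) i (B.diag (n + 1) a x) = B.diag n a (B.codeg (n + 1) i x)
  | n, 0, _, a, x => B.counitFirst_diagStep (B.diag n) (B.diag_source n) hε a x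
  | 0, 1, _, a, x => B.counitLast_diagStep hε a x
  | 0, i + 2, hi, _, _ => absurd hi (by omega)
  | n + 1, i + 1, hi, a, x => B.diagStep_whisker (B.diag (n + 1)) (B.diag_source (n + 1))
      (B.diag n) (B.diag_source n) (B.codegAux (n + 1) i).1
      (B.codegAux (n + 1) i).2 (diag_codeg hε n i (by omega)) a x

/-! ### Appending a tensor factor -/

/-- The map `x ↦ x ⊗ h`, from `H^{⊗_R (n+1)}` to `H^{⊗_R (n+2)}`, with its left linearity. -/
def appendAux (h : H) : (n : ℕ) → {f : B.cn (n + 1) →ₗ[k] B.cn (n + 2) // IsLeftLinear f}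
  | 0 => ⟨(tmul B.bim B.bim).flip h, fun _ _ => rfl⟩
  | n + 1 => ⟨B.whisker (appendAux h n).1 (appendAux h n).2, B.whisker_left _ _⟩

/-- The map `x ↦ x ⊗ h`, from `H^{⊗_R (n+1)}` to `H^{⊗_R (n+2)}`. -/
def append (h : H) (n : ℕ) : B.cn (n + 1) →ₗ[k] B.cn (n + 2) := (B.appendAux h n).1

theorem append_left (h : H) (n : ℕ) : IsLeftLinear (B.append h n) := (B.appendAux h n).2

/-- Linear maps out of `H^{⊗_R (n+2)} = H ⊗_R H^{⊗_R (n+1)}` agree if they agree on the elements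
`x ⊗ y`. -/
theorem cn_hom_ext {n : ℕ} {Q : Type*} [AddCommGroup Q] [Module k Q] {f g : B.cn (n + 2) →ₗ[k] Q}
    (h : ∀ (x : H) (y : B.cn (n + 1)),
      f (tmul B.bim (B.cn (n + 1)) x y) = g (tmul B.bim (B.cn (n + 1)) x y)) : f = g :=
  tensor_hom_ext h

theorem append_succ_tmul (h : H) (n : ℕ) (x : H) (y : B.cn (n + 1)) :
    B.append h (n + 1) (tmul B.bim (B.cn (n + 1)) x y) =
      tmul B.bim (B.cn (n + 2)) x (B.append h n y) :=
  B.whisker_tmul (B.appendAux h n).1 (B.appendAux h n).2 x y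

/-- The last coface is `x ↦ x ⊗ 1`. -/
theorem cofaceSucc_last : ∀ n, (B.cofaceSucc (n + 1) (n + 1)).1 = B.append 1 n
  | 0 => rfl
  | n + 1 => B.cn_hom_ext fun x y =>
    (B.whisker_tmul (B.cofaceSucc (n + 1) (n + 1)).1 (B.cofaceSucc (n + 1) (n + 1)).2 x y).trans
      ((congrArg (tmul B.bim (B.cn (n + 2)) x)
        (LinearMap.congr_fun (cofaceSucc_last n) y)).trans (B.append_succ_tmul 1 n x y).symm)

theorem coface_last (n : ℕ) : B.coface (n + 1) (n + 2) = B.append 1 n := B.cofaceSucc_last n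

theorem append_pure : ∀ (h : H) (n : ℕ) (g : Fin (n + 1) → H),
    B.append h n (B.pure n g) = B.pure (n + 1) (Fin.snoc g h)
  | _, 0, _ => rfl
  | h, n + 1, g => by
    have e0 : (Fin.snoc g h : Fin (n + 3) → H) 0 = g 0 :=
      Fin.snoc_castSucc (α := fun _ => H) h g 0
    rw [pure_succ, append_succ_tmul, append_pure, pure_succ (n := n + 1), tail_snoc, e0]

/-- `σ_{n+1}(x ⊗ h) = x ε(h)`. -/
theorem codeg_last_append (h : H) : ∀ n : ℕ,
    B.codeg (n + 1) (n + 1) ∘ₗ B.append h n = (B.cn (n + 1)).right (op (B.ε h))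
  | 0 => LinearMap.ext fun (x : H) => B.counitLast_tmul x h
  | n + 1 => B.cn_hom_ext fun x y => by
    have e := congrArg (B.codeg (n + 2) (n + 2)) (B.append_succ_tmul h n x y)
    have e' : B.codeg (n + 2) (n + 2) (tmul B.bim (B.cn (n + 2)) x (B.append h n y)) =
        tmul B.bim (B.cn (n + 1)) x (B.codeg (n + 1) (n + 1) (B.append h n y)) :=
      B.whisker_tmul (B.codegAux (n + 1) (n + 1)).1 (B.codegAux (n + 1) (n + 1)).2 _ _
    have e'' := congrArg (tmul B.bim (B.cn (n + 1)) x)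
      (LinearMap.congr_fun (codeg_last_append h n) y)
    exact e.trans (e'.trans e'')

/-- `(x ⊗ h) r = x ⊗ β(r) h`. -/
theorem right_append (h : H) (r : R) : ∀ n : ℕ,
    (B.cn (n + 2)).right (op r) ∘ₗ B.append h n = B.append (B.β (op r) * h) n
  | 0 => rfl
  | n + 1 => B.cn_hom_ext fun x y =>
    (congrArg ((B.cn (n + 3)).right (op r)) (B.append_succ_tmul h n x y)).trans <|
    (congrArg (tmul B.bim (B.cn (n + 2)) x) (LinearMap.congr_fun (right_append h r n) y)).trans
      (B.append_succ_tmul _ n x y).symm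

theorem diagStep_target (ρ : H →ₐ[k] Module.End k N) (hρ : ∀ r, ρ (B.α r) = N.left r)
    (r : R) (x : H) (y : N) : B.diagStep N ρ hρ (B.β (op r)) (tmul B.bim N x y) =
      tmul B.bim N x (ρ (B.β (op r)) y) := by
  rw [diagStep_eq_mulMap, Δ_target, mulMap_tmul, one_mul, orbit_apply]

theorem diag_succ_target (r : R) (n : ℕ) (x : H) (y : B.cn (n + 1)) :
    B.diag (n + 1) (B.β (op r)) (tmul B.bim (B.cn (n + 1)) x y) =
      tmul B.bim (B.cn (n + 1)) x (B.diag n (B.β (op r)) y) :=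
  B.diagStep_target (B.diag n) (B.diag_source n) r x y

/-- `β(r) ▷ (x ⊗ h) = x ⊗ β(r) h`. -/
theorem diag_target_append (h : H) (r : R) : ∀ n : ℕ,
    B.diag (n + 1) (B.β (op r)) ∘ₗ B.append h n = B.append (B.β (op r) * h) n
  | 0 => LinearMap.ext fun (x : H) => B.diag_succ_target r 0 x h
  | n + 1 => B.cn_hom_ext fun x y => by
    have e := congrArg (B.diag (n + 2) (B.β (op r))) (B.append_succ_tmul h n x y)
    have e' := congrArg (tmul B.bim (B.cn (n + 2)) x)
      (LinearMap.congr_fun (diag_target_append h r n) y)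
    exact e.trans ((B.diag_succ_target r (n + 1) x _).trans
      (e'.trans (B.append_succ_tmul _ n x y).symm))

/-- Linear maps out of `H^{⊗_R (n+1)}` agree if they agree on pure tensors. -/
theorem hom_ext_pure {Q : Type*} [AddCommGroup Q] [Module k Q] : ∀ {n : ℕ}
    {f g : B.cn (n + 1) →ₗ[k] Q}, (∀ v, f (B.pure n v) = g (B.pure n v)) → f = g
  | 0, _, _, h => LinearMap.ext fun (x : H) => h fun _ => x
  | n + 1, f, g, h => B.cn_hom_ext fun x y => by
    let t : B.cn (n + 1) →ₗ[k] B.cn (n + 2) := tmul B.bim (B.cn (n + 1)) x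
    have e : f ∘ₗ t = g ∘ₗ t := hom_ext_pure fun v => h (Fin.cons x v : Fin (n + 2) → H)
    exact LinearMap.congr_fun e y

/-! ### The antipode -/

section antipode

variable (T : Hᵐᵒᵖ →ₐ[k] H) (hT : ∀ r, T (op (B.β (op r))) = B.α r)

theorem mulAnti_tmul (x y : H) : B.mulAnti T hT (tmul B.bim B.bim x y) = T (op x) * y :=
  tensorLift_tmul (M := B.bim) (N := B.bim) _ _ x y

/-- The counit satisfies `ε(ab) = ε(a α(ε(b)))`. Indeed
`β ε T(gh) = T(h⁽¹⁾) T(g⁽¹⁾) g⁽²⁾ h⁽²⁾ = T(h⁽¹⁾) (β ε T(g)) h⁽²⁾ = β ε T((β ε T(g)) h)`, and `β` is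
injective and `T` surjective. -/
theorem ε_mul (hT₂ : ∀ h : H, B.mulAnti T hT (B.Δ h) = B.β (op (B.ε (T (op h)))))
    (hsq : ∀ h, T (op (T (op h))) = h) (a b : H) : B.ε (a * b) = B.ε (a * B.α (B.ε b)) := by
  have key (g h : H) : B.ε (T (op (g * h))) = B.ε (T (op (B.β (op (B.ε (T (op g)))) * h))) := by
    apply B.target_injective
    obtain ⟨w, hw⟩ := proj_surjective (M := B.bim) (N := B.bim) (B.Δ h)
    have hr : B.Δ (B.β (op (B.ε (T (op g)))) * h) =
      (tensor B.bim B.bim).right (op (B.ε (T (op g)))) (B.Δ h) := B.Δ_right _ h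
    rw [← hT₂, ← hT₂, B.Δ_mul g h w hw, hr, ← hw]
    clear hw hr
    induction w with
    | zero => simp
    | tmul c d =>
      rw [proj_tmul, tensor_right_tmul]
      refine Eq.trans ?_ (B.mulAnti_tmul T hT c (B.β (op (B.ε (T (op g)))) * d)).symm
      rw [← hT₂ g]
      generalize B.Δ g = u
      induction u using tensorInduction with
      | tm p q =>
        refine (congrArg (B.mulAnti T hT) (B.rightAct_tmul p q c d)).trans ?_
        refine (B.mulAnti_tmul T hT _ _).trans ?_
        rw [mulAnti_tmul, op_mul, map_mul, mul_assoc, mul_assoc]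
      | ad a b ha hb =>
        rw [map_add, LinearMap.add_apply, map_add, ha, hb, map_add, add_mul, mul_add]
    | add c d hc hd => rw [map_add, map_add, hc, hd, map_add, map_add, map_add]
  have h := key (T (op b)) (T (op a))
  rwa [op_mul, map_mul T, hsq, hsq, op_mul, map_mul T, hsq, hT] at h

/-- The map `H ⊗_R H → N'`, `p ⊗ q ↦ T(p) f(q z)`, for a left linear map `f : N → N'` of
`H`-modules and `z` in `N`. -/
def antiMap (f : N →ₗ[k] N') (hf : IsLeftLinear f)
    (ρ : H →ₐ[k] Module.End k N) (hρ : ∀ r, ρ (B.α r) = N.left r)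
    (ρ' : H →ₐ[k] Module.End k N') (hρ' : ∀ r, ρ' (B.α r) = N'.left r) (z : N) :
    tensor B.bim B.bim →ₗ[k] N' :=
  tensorLift (M := B.bim) (N := B.bim)
    ((ρ'.toLinearMap ∘ₗ lin T).compl₂ (f ∘ₗ B.orbit ρ z)) (by
      intro r x y
      change ρ' (T (op (B.β (op r) * x))) (f (ρ y z)) =
        ρ' (T (op x)) (f (B.orbit ρ z (B.bim.left r y)))
      rw [B.anti_source T hT, B.orbit_left ρ hρ, hf, map_mul, hρ']
      rfl)

theorem antiMap_tmul (f : N →ₗ[k] N') (hf : IsLeftLinear f)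
    (ρ : H →ₐ[k] Module.End k N) (hρ : ∀ r, ρ (B.α r) = N.left r)
    (ρ' : H →ₐ[k] Module.End k N') (hρ' : ∀ r, ρ' (B.α r) = N'.left r) (z : N) (p q : H) :
    B.antiMap T hT f hf ρ hρ ρ' hρ' z (tmul B.bim B.bim p q) = ρ' (T (op p)) (f (ρ q z)) :=
  tensorLift_tmul (M := B.bim) (N := B.bim) _ _ p q

/-- `T(p) ▷ (q x ⊗ y) = T(p)⁽¹⁾ q x ⊗ T(p)⁽²⁾ y` is a function of `twist(p ⊗ q)`. -/
theorem diagStep_anti (ρ : H →ₐ[k] Module.End k N) (hρ : ∀ r, ρ (B.α r) = N.left r)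
    (p q x : H) (y : N) : B.diagStep N ρ hρ (T (op p)) (tmul B.bim N (q * x) y) =
      B.mulMap x (B.orbit ρ y) (B.orbit_left ρ hρ y)
        (B.twist T hT (tmul B.bim B.bim p q)) := by
  rw [twist_tmul, diagStep_eq_mulMap]
  generalize B.Δ (T (op p)) = u
  induction u using tensorInduction with
  | tm c d =>
    refine Eq.trans ?_ (congrArg (B.mulMap x (B.orbit ρ y) (B.orbit_left ρ hρ y))
      (B.rightAct_tmul c d q 1)).symm
    refine Eq.trans ?_ (B.mulMap_tmul (N := B.bim) _ _ _ _ _).symm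
    rw [mulMap_tmul, mul_one, mul_assoc]
  | ad a b ha hb =>
    rw [map_add, map_add, LinearMap.add_apply, map_add, ha, hb]

/-- `T(a⁽¹⁾) ▷ (a⁽²⁾ x ⊗ f(a⁽³⁾ y)) = x ⊗ T(a⁽¹⁾) f(a⁽²⁾ y)`: by coassociativity the twist
identity applies to the first two of the three coproduct factors. -/
theorem antiMap_whisker_Δ
    (htw : ∀ h : H, B.twist T hT (B.Δ h) = tmul B.bim B.bim (1 : H) (T (op h)))
    (f : N →ₗ[k] N') (hf : IsLeftLinear f)
    (ρ : H →ₐ[k] Module.End k N) (hρ : ∀ r, ρ (B.α r) = N.left r)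
    (ρ' : H →ₐ[k] Module.End k N') (hρ' : ∀ r, ρ' (B.α r) = N'.left r) (x : H) (y : N) (a : H) :
    B.antiMap T hT (B.whisker f hf) (B.whisker_left f hf) (B.diagStep N ρ hρ)
        (B.diagStep_source N ρ hρ) (B.diagStep N' ρ' hρ') (B.diagStep_source N' ρ' hρ')
        (tmul B.bim N x y) (B.Δ a) =
      tmul B.bim N' x (B.antiMap T hT f hf ρ hρ ρ' hρ' y (B.Δ a)) := by
  have hg : IsLeftLinear (f ∘ₗ B.orbit ρ y) := hf.comp (B.orbit_left ρ hρ y)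
  let m : tensor B.bim B.bim →ₗ[k] tensor B.bim N' := B.mulMap x (f ∘ₗ B.orbit ρ y) hg
  have hm : IsLeftLinear m := B.mulMap_left x _ hg
  -- `p ⊗ (q ⊗ s) ↦ T(p) ▷ (q x ⊗ f(s y))`
  let G : tensor B.bim (tensor B.bim B.bim) →ₗ[k] tensor B.bim N' :=
    tensorLift (M := B.bim) (N := tensor B.bim B.bim)
      (((B.diagStep N' ρ' hρ').toLinearMap ∘ₗ lin T).compl₂ m) (by
        intro r p w
        change B.diagStep N' ρ' hρ' (T (op (B.β (op r) * p))) (m w) =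
          B.diagStep N' ρ' hρ' (T (op p)) (m ((tensor B.bim B.bim).left r w))
        rw [B.anti_source T hT, hm, map_mul, diagStep_source]
        rfl)
  have hG (p : H) (w : tensor B.bim B.bim) : G (tmul B.bim (tensor B.bim B.bim) p w) =
      B.diagStep N' ρ' hρ' (T (op p)) (m w) :=
    tensorLift_tmul (M := B.bim) (N := tensor B.bim B.bim) _ _ p w
  have hG' (u : tensor B.bim B.bim) (s : H) :
      G (assoc B.bim B.bim B.bim (tmul (tensor B.bim B.bim) B.bim u s)) =
        B.mulMap x (B.orbit ρ' (f (ρ s y))) (B.orbit_left ρ' hρ' _) (B.twist T hT u) := by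
    induction u using tensorInduction with
    | tm p q =>
      rw [assoc_tmul, hG, ← B.diagStep_anti T hT]
      exact congrArg (B.diagStep N' ρ' hρ' (T (op p))) (B.mulMap_tmul x _ hg q s)
    | ad a b ha hb => simp only [map_add, LinearMap.add_apply, ha, hb]
  refine Eq.trans ?_ ((congrArg G (B.coassoc a)).symm.trans ?_)
  · generalize B.Δ a = u
    induction u using tensorInduction with
    | tm p q =>
      rw [antiMap_tmul, tensorMap_tmul]
      refine Eq.trans (congrArg (B.diagStep N' ρ' hρ' (T (op p))) ?_) (hG p (B.Δ q)).symm
      rw [diagStep_eq_mulMap]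
      generalize B.Δ q = w
      induction w using tensorInduction with
      | tm c d =>
        rw [mulMap_tmul, whisker_tmul]
        exact (B.mulMap_tmul x _ hg c d).symm
      | ad a b ha hb => rw [map_add, map_add, ha, hb, map_add]
    | ad a b ha hb => simp only [map_add, ha, hb]
  · generalize B.Δ a = u
    induction u using tensorInduction with
    | tm p q =>
      rw [antiMap_tmul, tensorMap_tmul]
      refine (hG' (B.Δ p) q).trans ?_
      rw [htw]
      refine (B.mulMap_tmul (N := B.bim) _ _ _ _ _).trans ?_
      rw [one_mul]
      rfl
    | ad a b ha hb => simp only [map_add, ha, hb]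

theorem antiMap_add (f : N →ₗ[k] N') (hf : IsLeftLinear f)
    (ρ : H →ₐ[k] Module.End k N) (hρ : ∀ r, ρ (B.α r) = N.left r)
    (ρ' : H →ₐ[k] Module.End k N') (hρ' : ∀ r, ρ' (B.α r) = N'.left r) (z z' : N)
    (u : tensor B.bim B.bim) :
    B.antiMap T hT f hf ρ hρ ρ' hρ' (z + z') u =
      B.antiMap T hT f hf ρ hρ ρ' hρ' z u + B.antiMap T hT f hf ρ hρ ρ' hρ' z' u := by
  induction u using tensorInduction with
  | tm p q => rw [antiMap_tmul, antiMap_tmul, antiMap_tmul, map_add, map_add, map_add]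
  | ad a b ha hb => simp only [map_add, ha, hb]; abel

/-- `T(a⁽¹⁾) ▷ (a⁽²⁾ ▷ z ⊗ h) = z ⊗ T(a) h`. -/
theorem antiMap_append
    (htw : ∀ h : H, B.twist T hT (B.Δ h) = tmul B.bim B.bim (1 : H) (T (op h))) (h a : H) :
    ∀ (n : ℕ) (z : B.cn (n + 1)),
    B.antiMap T hT (B.append h n) (B.append_left h n) (B.diag n) (B.diag_source n)
      (B.diag (n + 1)) (B.diag_source (n + 1)) z (B.Δ a) = B.append (T (op a) * h) n z
  | 0, z => by
    -- `twist(p ⊗ q) = c ⊗ d` goes to `c z ⊗ d h`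
    let m := B.mulMap (N := B.bim) (N' := B.cn 1) z (B.orbit (B.diag 0) h)
      (B.orbit_left (B.diag 0) (B.diag_source 0) _)
    have e (u : tensor B.bim B.bim) :
        B.antiMap T hT (B.append h 0) (B.append_left h 0) (B.diag 0) (B.diag_source 0)
          (B.diag 1) (B.diag_source 1) z u = m (B.twist T hT u) := by
      induction u using tensorInduction with
      | tm p q =>
        rw [antiMap_tmul]
        exact B.diagStep_anti T hT (B.diag 0) (B.diag_source 0) p q z h
      | ad a b ha hb =>
        rw [map_add, ha, hb, map_add, map_add]
        rfl
    rw [e, htw]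
    refine (B.mulMap_tmul (N := B.bim) (N' := B.cn 1) _ _ _ _ _).trans ?_
    exact congrArg (fun w : H => tmul B.bim (B.cn 1) w (T (op a) * h : H)) (one_mul (M := H) z)
  | n + 1, z => by
    induction z using tensorInduction (M := B.bim) (N := B.cn (n + 1)) with
    | tm x y =>
      refine (B.antiMap_whisker_Δ T hT htw (B.append h n) (B.append_left h n) (B.diag n)
        (B.diag_source n) (B.diag (n + 1)) (B.diag_source (n + 1)) x y a).trans ?_
      rw [antiMap_append htw h a n y]
      exact (B.append_succ_tmul _ n x y).symm
    | ad z z' hz hz' =>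
      exact (B.antiMap_add T hT _ _ _ _ _ _ _ _ _).trans
        ((congrArg₂ (· + ·) hz hz').trans (map_add (B.append (T (op a) * h) (n + 1)) _ _).symm)

/-! ### The cyclic operator -/

theorem tau_tmul_append (n : ℕ) (h : H) (x : B.cn (n + 1)) :
    B.tau T hT (n + 2) (tmul B.bim (B.cn (n + 1)) h x) =
      B.diag (n + 1) (T (op h)) (B.append 1 n x) := by
  rw [tau_tmul, coface_last]

/-- One step of the rotation: `τ(T(h) ▷ (g ⊗ z)) = T(g) ▷ (z ⊗ h)`. -/
theorem tau_diag
    (htw : ∀ h : H, B.twist T hT (B.Δ h) = tmul B.bim B.bim (1 : H) (T (op h)))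
    (hsq : ∀ h, T (op (T (op h))) = h) (n : ℕ) (h g : H) (z : B.cn (n + 1)) :
    B.tau T hT (n + 2) (B.diag (n + 1) (T (op h)) (tmul B.bim (B.cn (n + 1)) g z)) =
      B.diag (n + 1) (T (op g)) (B.append h n z) := by
  have e (u : tensor B.bim B.bim) :
      B.tau T hT (n + 2) (B.mulMap g (B.orbit (B.diag n) z)
          (B.orbit_left (B.diag n) (B.diag_source n) z) u) =
        B.diag (n + 1) (T (op g)) (B.antiMap T hT (B.append 1 n) (B.append_left 1 n) (B.diag n)
          (B.diag_source n) (B.diag (n + 1)) (B.diag_source (n + 1)) z u) := by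
    induction u using tensorInduction with
    | tm p q =>
      rw [mulMap_tmul, antiMap_tmul]
      refine (B.tau_tmul_append T hT n (p * g) _).trans ?_
      rw [op_mul, map_mul, map_mul]
      rfl
    | ad a b ha hb =>
      rw [map_add, map_add, map_add]
      exact (map_add (B.tau T hT (n + 2)) _ _).trans (congrArg₂ (· + ·) ha hb)
  refine (congrArg (B.tau T hT (n + 2))
    (B.diagStep_eq_mulMap (B.diag n) (B.diag_source n) (T (op h)) g z)).trans ?_
  rw [e, antiMap_append B T hT htw, hsq, mul_one]

/-- The elements `T(v₀) ▷ (v₁ ⊗ ⋯ ⊗ vₙ₊₁)` of `H^{⊗_R (n+1)}`. -/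
def word (n : ℕ) (v : Fin (n + 2) → H) : B.cn (n + 1) :=
  B.diag n (T (op (v 0))) (B.pure n (Fin.tail v))

/-- The cyclic operator rotates words. -/
theorem tau_word (htw : ∀ h : H, B.twist T hT (B.Δ h) = tmul B.bim B.bim (1 : H) (T (op h)))
    (hsq : ∀ h, T (op (T (op h))) = h) (n : ℕ) (v : Fin (n + 2) → H) :
    B.tau T hT (n + 1) (B.word T n v) = B.word T n (v ∘ finRotate (n + 2)) := by
  have e0 : (Fin.snoc (Fin.tail v) (v 0) : Fin (n + 2) → H) 0 = v 1 :=
    Fin.snoc_castSucc (α := fun _ => H) (v 0) (Fin.tail v) 0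
  rw [← snoc_tail_eq_comp_finRotate, word, word, tail_snoc, e0]
  match n with
  | 0 =>
    change T (op (T (op (v 0)) * v 1)) = T (op (v 1)) * v 0
    rw [op_mul, map_mul, hsq]
  | n + 1 =>
    rw [pure_succ, tau_diag B T hT htw hsq, append_pure]
    rfl

theorem tau_iterate (htw : ∀ h : H, B.twist T hT (B.Δ h) = tmul B.bim B.bim (1 : H) (T (op h)))
    (hsq : ∀ h, T (op (T (op h))) = h) : ∀ (n : ℕ) (x : B.cn n),
    (B.tau T hT n)^[n + 1] x = x
  | 0, _ => rfl
  | n + 1, x => by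
    have iter (m : ℕ) (v : Fin (n + 2) → H) : (B.tau T hT (n + 1))^[m] (B.word T n v) =
        B.word T n (v ∘ (finRotate (n + 2) ^ m : Equiv.Perm (Fin (n + 2)))) := by
      induction m generalizing v with
      | zero => rfl
      | succ m ih =>
        rw [Function.iterate_succ_apply, tau_word B T hT htw hsq, ih, pow_succ']
        rfl
    have e : (B.tau T hT (n + 1)) ^ (n + 2) = LinearMap.id := B.hom_ext_pure fun v => by
      have hv : B.pure n v = B.word T n (Fin.cons 1 v) := by
        rw [word, Fin.cons_zero, op_one, map_one, map_one, Fin.tail_cons]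
        rfl
      rw [Module.End.pow_apply, hv, iter, finRotate_pow]
      rfl
    rw [← Module.End.pow_apply, e]
    rfl

end antipode

/-! ### Compatibility of the cyclic operator with cofaces and codegeneracies -/

theorem coface_zero_tmul (n : ℕ) (x : B.cn (n + 1)) :
    B.coface (n + 1) 0 x = tmul B.bim (B.cn (n + 1)) (1 : H) x := rfl

theorem coface_add_two_tmul (n i : ℕ) (h : H) (x : B.cn (n + 1)) :
    B.coface (n + 2) (i + 2) (tmul B.bim (B.cn (n + 1)) h x) =
      tmul B.bim (B.cn (n + 2)) h (B.coface (n + 1) (i + 1) x) :=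
  B.whisker_tmul (B.cofaceSucc (n + 1) i).1 (B.cofaceSucc (n + 1) i).2 h x

theorem codeg_zero_tmul (n : ℕ) (h : H) (x : B.cn (n + 1)) :
    B.codeg (n + 1) 0 (tmul B.bim (B.cn (n + 1)) h x) = (B.cn (n + 1)).left (B.ε h) x :=
  B.counitFirst_tmul h x

theorem codeg_succ_tmul (n i : ℕ) (h : H) (x : B.cn (n + 2)) :
    B.codeg (n + 2) (i + 1) (tmul B.bim (B.cn (n + 2)) h x) =
      tmul B.bim (B.cn (n + 1)) h (B.codeg (n + 1) i x) :=
  B.whisker_tmul (B.codegAux (n + 1) i).1 (B.codegAux (n + 1) i).2 h x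

section antipode

variable (T : Hᵐᵒᵖ →ₐ[k] H) (hT : ∀ r, T (op (B.β (op r))) = B.α r)

theorem anti_source_eq_target (hT : ∀ r, T (op (B.β (op r))) = B.α r)
    (hsq : ∀ h, T (op (T (op h))) = h) (r : R) : T (op (B.α r)) = B.β (op r) := by
  rw [← hT, hsq]

theorem tau_two (u : tensor B.bim B.bim) : B.tau T hT 2 u = B.twist T hT u := by
  refine LinearMap.congr_fun (f := B.tau T hT 2) (g := B.twist T hT) ?_ u
  refine B.cn_hom_ext fun x y => ?_
  refine (B.tau_tmul T hT 0 x y).trans ?_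
  refine Eq.trans ?_ (B.twist_tmul T hT x y).symm
  exact B.diagStep_tmul B.bim (Algebra.lmul k H) B.lmul_source _ y (1 : H)

theorem tau_coface_zero : ∀ n, B.tau T hT (n + 1) ∘ₗ B.coface n 0 = B.coface n (n + 1)
  | 0 => LinearMap.ext hT
  | n + 1 => LinearMap.ext fun x => by
    rw [coface_last, LinearMap.comp_apply, coface_zero_tmul, tau_tmul_append, op_one, map_one,
      map_one, Module.End.one_apply]

/-- `τ_{n+1} δ₁ = δ₀ τₙ`; for `n ≥ 1` this is the twist identity acting on `1 ⊗ (x ⊗ 1)`. -/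
theorem tau_coface_one (htw : ∀ h : H, B.twist T hT (B.Δ h) = tmul B.bim B.bim (1 : H) (T (op h)))
    (hsq : ∀ h, T (op (T (op h))) = h) : ∀ n,
    B.tau T hT (n + 1) ∘ₗ B.coface n 1 = B.coface n 0 ∘ₗ B.tau T hT n
  | 0 => LinearMap.ext fun r => B.anti_source_eq_target T hT hsq r
  | 1 => LinearMap.ext fun h => (B.tau_two T hT (B.Δ h)).trans (htw h)
  | n + 2 => B.cn_hom_ext fun h x => by
    let y := B.append 1 n x
    have hy := B.orbit_left (B.diag (n + 1)) (B.diag_source (n + 1)) y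
    have e (u : tensor B.bim B.bim) : B.tau T hT (n + 3) (assoc B.bim B.bim (B.cn (n + 1))
          (tmul (tensor B.bim B.bim) (B.cn (n + 1)) u x)) =
        B.mulMap (1 : H) (B.orbit (B.diag (n + 1)) y) hy (B.twist T hT u) := by
      induction u using tensorInduction with
      | tm p q =>
        rw [assoc_tmul, ← B.diagStep_anti T hT _ (B.diag_source (n + 1)), mul_one]
        refine (B.tau_tmul_append T hT (n + 1) p _).trans ?_
        exact congrArg (B.diag (n + 2) (T (op p))) (B.append_succ_tmul 1 n q x)
      | ad a b ha hb =>
        rw [map_add, map_add, map_add, LinearMap.add_apply, map_add]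
        exact (map_add (B.tau T hT (n + 3)) _ _).trans (congrArg₂ (· + ·) ha hb)
    refine (congrArg (B.tau T hT (n + 3)) (B.comulFirst_tmul h x)).trans ?_
    rw [e, htw]
    refine (B.mulMap_tmul (N := B.bim) _ _ _ _ _).trans ?_
    rw [mul_one]
    exact congrArg (tmul B.bim (B.cn (n + 2)) (1 : H)) (B.tau_tmul_append T hT n h x).symm

/-- For `i ≥ 1` the relation follows from `δ_i δ_n = δ_{n+1} δ_i` and linearity for the diagonal
action. -/
theorem tau_coface_succ
    (htw : ∀ h : H, B.twist T hT (B.Δ h) = tmul B.bim B.bim (1 : H) (T (op h)))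
    (hsq : ∀ h, T (op (T (op h))) = h) : ∀ n i, i ≤ n →
    B.tau T hT (n + 1) ∘ₗ B.coface n (i + 1) = B.coface n i ∘ₗ B.tau T hT n
  | n, 0, _ => B.tau_coface_one T hT htw hsq n
  | 0, i + 1, hi => absurd hi (by omega)
  | 1, 1, _ => LinearMap.ext fun (h : H) => by
    refine (B.tau_tmul T hT 0 h (1 : H)).trans ?_
    refine (B.diagStep_tmul B.bim (Algebra.lmul k H) B.lmul_source _ (1 : H) (1 : H)).trans ?_
    have e : B.Δ (T (op h) * 1) = B.rightAct (B.Δ (T (op h))) ((1 : H) ⊗ₜ (1 : H)) :=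
      B.Δ_mul _ _ _ B.Δ_one.symm
    exact e.symm.trans (congrArg B.Δ (mul_one _))
  | 1, i + 2, hi => absurd hi (by omega)
  | n + 2, i + 1, hi => B.cn_hom_ext fun h x => by
    change B.tau T hT (n + 3) (B.coface (n + 2) (i + 2) (tmul B.bim (B.cn (n + 1)) h x)) =
      B.coface (n + 2) (i + 1) (B.tau T hT (n + 2) (tmul B.bim (B.cn (n + 1)) h x))
    rw [coface_add_two_tmul, tau_tmul_append, tau_tmul_append]
    have e := LinearMap.congr_fun
      (B.coface_coface (n + 1) (i + 1) (n + 2) (by omega) le_rfl) x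
    rw [LinearMap.comp_apply, LinearMap.comp_apply, coface_last, coface_last] at e
    rw [e]
    exact (B.diag_cofaceSucc (n + 1) i (by omega) _ _).symm

theorem tau_codeg_succ (hε : ∀ a b : H, B.ε (a * b) = B.ε (a * B.α (B.ε b))) : ∀ n i, i + 1 ≤ n →
    B.tau T hT n ∘ₗ B.codeg n (i + 1) = B.codeg n i ∘ₗ B.tau T hT (n + 1)
  | 0, i, hi => absurd hi (by omega)
  | 1, 0, _ => B.cn_hom_ext fun x y => by
    have e := LinearMap.congr_fun (B.codeg_cofaceSucc_of_gt 0 0 0 le_rfl le_rfl) y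
    rw [LinearMap.comp_apply, LinearMap.comp_apply] at e
    change _ = B.codeg 1 0 (B.tau T hT 2 (tmul B.bim (B.cn 1) x y))
    rw [tau_tmul, B.diag_codeg hε 0 0 (by omega)]
    refine Eq.trans ?_ (congrArg (B.diag 0 (T (op x))) e.symm)
    refine (congrArg (fun z : H => T (op z)) (B.counitLast_tmul x y)).trans ?_
    exact B.anti_source T hT _ _
  | 1, i + 1, hi => absurd hi (by omega)
  | n + 2, i, hi => B.cn_hom_ext fun x y => by
    change B.tau T hT (n + 2) (B.codeg (n + 2) (i + 1) (tmul B.bim (B.cn (n + 2)) x y)) =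
      B.codeg (n + 2) i (B.tau T hT (n + 3) (tmul B.bim (B.cn (n + 2)) x y))
    rw [codeg_succ_tmul, tau_tmul_append, tau_tmul_append, B.diag_codeg hε (n + 1) i (by omega)]
    have e := LinearMap.congr_fun (B.codeg_cofaceSucc_of_gt (n + 1) (n + 1) i (by omega) le_rfl) y
    rw [LinearMap.comp_apply, LinearMap.comp_apply, cofaceSucc_last, cofaceSucc_last] at e
    rw [e]

/-- `σ_{n+2}(x ⊗ 1 ⊗ h) = β(ε(h)) ▷ (x ⊗ 1)`: both sides equal `x ⊗ β(ε(h))`. -/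
theorem codeg_append_append (n : ℕ) (h : H) (x : B.cn (n + 1)) :
    B.codeg (n + 2) (n + 2) (B.append h (n + 1) (B.append 1 n x)) =
      B.diag (n + 1) (B.β (op (B.ε h))) (B.append 1 n x) := by
  have e := LinearMap.congr_fun (B.codeg_last_append h (n + 1)) (B.append 1 n x)
  have e' := LinearMap.congr_fun (B.right_append 1 (B.ε h) n) x
  have e'' := LinearMap.congr_fun (B.diag_target_append 1 (B.ε h) n) x
  exact e.trans (e'.trans e''.symm)

/-- By two rotations `τ²(h ⊗ g ⊗ y) = T(g) ▷ (y ⊗ 1 ⊗ h)`, and the last codegeneracy turns this into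
`T(g) β(ε(h)) ▷ (y ⊗ 1) = T(α(ε(h)) g) ▷ (y ⊗ 1)`. -/
theorem tau_codeg_zero
    (htw : ∀ h : H, B.twist T hT (B.Δ h) = tmul B.bim B.bim (1 : H) (T (op h)))
    (hsq : ∀ h, T (op (T (op h))) = h)
    (hε : ∀ a b : H, B.ε (a * b) = B.ε (a * B.α (B.ε b))) : ∀ n,
    B.tau T hT n ∘ₗ B.codeg n 0 = B.codeg n n ∘ₗ B.tau T hT (n + 1) ∘ₗ B.tau T hT (n + 1)
  | 0 => LinearMap.ext fun (h : H) => congrArg B.ε (hsq h).symm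
  | 1 => B.cn_hom_ext fun h g => by
    have e : B.tau T hT 2 (B.tau T hT 2 (tmul B.bim (B.cn 1) h g)) =
        B.diag 1 (T (op g)) (B.append h 0 (1 : H)) := by
      rw [tau_tmul_append]
      exact B.tau_diag T hT htw hsq 0 h g (1 : H)
    have e' := B.diag_codeg hε 0 1 le_rfl (T (op g)) (B.append h 0 (1 : H))
    have e'' := LinearMap.congr_fun (B.codeg_last_append h 0) (1 : H)
    refine Eq.trans ?_ ((congrArg (B.codeg 1 1) e).trans (e'.trans
      (congrArg (B.diag 0 (T (op g))) e''))).symm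
    refine (congrArg (fun z : H => T (op z)) (B.codeg_zero_tmul 0 h g)).trans ?_
    have e₃ : ∀ g : H, T (op (B.α (B.ε h) * g)) = T (op g) * (B.β (op (B.ε h)) * 1) := fun g => by
      rw [op_mul, map_mul, B.anti_source_eq_target T hT hsq, mul_one]
    exact e₃ g
  | n + 2 => B.cn_hom_ext fun h x => by
    induction x using tensorInduction (M := B.bim) (N := B.cn (n + 1)) with
    | tm g y =>
      let x : B.cn (n + 2) := tmul B.bim (B.cn (n + 1)) g y
      have e : B.tau T hT (n + 3) (B.tau T hT (n + 3) (tmul B.bim (B.cn (n + 2)) h x)) =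
          B.diag (n + 2) (T (op g)) (B.append h (n + 1) (B.append 1 n y)) := by
        rw [tau_tmul_append, B.append_succ_tmul 1 n g y]
        exact B.tau_diag T hT htw hsq (n + 1) h g (B.append 1 n y)
      have e' : B.tau T hT (n + 2) (B.codeg (n + 2) 0 (tmul B.bim (B.cn (n + 2)) h x)) =
          B.diag (n + 1) (T (op (B.α (B.ε h) * g))) (B.append 1 n y) :=
        (congrArg (B.tau T hT (n + 2)) (B.codeg_zero_tmul (n + 1) h x)).trans
          (B.tau_tmul_append T hT n (B.α (B.ε h) * g) y)
      change B.tau T hT (n + 2) (B.codeg (n + 2) 0 (tmul B.bim (B.cn (n + 2)) h x)) =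
        B.codeg (n + 2) (n + 2)
          (B.tau T hT (n + 3) (B.tau T hT (n + 3) (tmul B.bim (B.cn (n + 2)) h x)))
      rw [e, e', B.diag_codeg hε (n + 1) (n + 2) le_rfl, codeg_append_append, op_mul, map_mul,
        B.anti_source_eq_target T hT hsq, map_mul, Module.End.mul_apply]
    | ad x x' hx hx' =>
      let F : B.cn (n + 2) →ₗ[k] B.cn (n + 3) := tmul B.bim (B.cn (n + 2)) h
      exact (map_add ((B.tau T hT (n + 2) ∘ₗ B.codeg (n + 2) 0) ∘ₗ F) x x').trans
        ((congrArg₂ (· + ·) hx hx').trans (map_add ((B.codeg (n + 2) (n + 2) ∘ₗ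
          B.tau T hT (n + 3) ∘ₗ B.tau T hT (n + 3)) ∘ₗ F) x x').symm)

theorem isCocyclic (hT₂ : ∀ h : H, B.mulAnti T hT (B.Δ h) = B.β (op (B.ε (T (op h)))))
    (hsq : ∀ h, T (op (T (op h))) = h)
    (htw : ∀ h : H, B.twist T hT (B.Δ h) = tmul B.bim B.bim (1 : H) (T (op h))) :
    IsCocyclic (C := fun n => B.cn n) B.coface B.codeg (B.tau T hT) where
  δ_δ := B.coface_coface
  σ_σ := B.codeg_codeg
  σ_δ_of_lt := B.codeg_coface_of_lt
  σ_δ_self := B.codeg_coface_self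
  σ_δ_succ n j hj := by
    rw [coface_succ]
    exact B.codeg_cofaceSucc_self n j hj
  σ_δ_of_gt n i j hji hi := by
    obtain ⟨i, rfl⟩ : ∃ i', i = i' + 1 := ⟨i - 1, by omega⟩
    rw [coface_succ, coface_succ]
    exact B.codeg_cofaceSucc_of_gt n i j (by omega) (by omega)
  τ_δ_succ := B.tau_coface_succ T hT htw hsq
  τ_δ_zero := B.tau_coface_zero T hT
  τ_σ_succ := B.tau_codeg_succ T hT (B.ε_mul T hT hT₂ hsq)
  τ_σ_zero := B.tau_codeg_zero T hT htw hsq (B.ε_mul T hT hT₂ hsq)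
  τ_pow := B.tau_iterate T hT htw hsq

end antipode

end Bialgebroid

end ParaHopf

theorem theorem3p1 {k : Type v} {R H : Type u} [Field k] [CharZero k]
    [Ring R] [Algebra k R] [Ring H] [Algebra k H]
    (B : ParaHopf.Bialgebroid k R H) (T : Hᵐᵒᵖ →ₐ[k] H)
    (hT₁ : ∀ r : R, T (op (B.β (op r))) = B.α r)
    (hT₂ : ∀ h : H, B.mulAnti T hT₁ (B.Δ h) = B.β (op (B.ε (T (op h))))) :
    (ParaHopf.IsCocyclic (C := fun n => B.cn n) B.coface B.codeg (B.tau T hT₁) ↔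
      (∀ h : H, T (op (T (op h))) = h) ∧
      ∀ h : H, B.twist T hT₁ (B.Δ h) =
        ParaHopf.RBimodule.tmul B.bim B.bim (1 : H) (T (op h))) ∧
    (ParaHopf.IsCocyclic (C := fun n => B.cn n) B.coface B.codeg (B.tau T hT₁) ↔
      B.IsParaHopf T) := by
  have main : ParaHopf.IsCocyclic (C := fun n => B.cn n) B.coface B.codeg (B.tau T hT₁) ↔
      (∀ h : H, T (op (T (op h))) = h) ∧
      ∀ h : H, B.twist T hT₁ (B.Δ h) =
        ParaHopf.RBimodule.tmul B.bim B.bim (1 : H) (T (op h)) := by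
    constructor
    · intro h
      refine ⟨h.τ_pow 1, fun x => ?_⟩
      rw [← B.tau_two T hT₁]
      exact LinearMap.congr_fun (h.τ_δ_succ 1 0 (Nat.zero_le 1)) x
    · rintro ⟨hsq, htw⟩
      exact B.isCocyclic T hT₁ hT₂ hsq htw
  refine ⟨main, main.trans ⟨fun h => ⟨hT₁, hT₂, h.1, h.2⟩, fun h => ⟨h.sq_eq, h.twist_eq⟩⟩⟩
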